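/- Let $\mathbb M_m$ be the algebra of complex $m\times m$ matrices, and write $\|\cdot\|$ for the norm of linear maps $L_2(\mathbb M_m,\mathrm{tr})\to L_2(\mathbb M_m,\mathrm{tr})$. A *generator* is a linear map $A$ on $\mathbb M_m$ such that every $T_t=e^{-tA}$, $t\ge 0$, is unital, completely positive and self-adjoint for $\langle x,y\rangle=\mathrm{tr}(x^*y)$. Let $N=\{x: T_t(x)=x \text{ for all } t\ge 0\}$ be its fixed-point algebra and $E_N$ the trace-preserving conditional expectation onto $N$. Put $\Gamma_A(x,y)=\frac12\big(A(x)^*y+x^*A(y)-A(x^*y)\big)$, and write $c\,\Gamma_A\le\Gamma_B$ if $c\,[\sum_l\Gamma_A(x_{li},x_{lj})]_{ij}\le[\sum_l\Gamma_B(x_{li},x_{lj})]_{ij}$ for all square matrices $(x_{ij})$ over $\mathbb M_m$. A generator $A$ satisfies $\lambda$-$\Gamma\mathcal E$ if $\lambda\,\Gamma_{I-E_N}\le\Gamma_A$. It satisfies $\lambda$-FLSI if $\lambda\, D(\rho\|E_N(\rho))\le I_A(\rho)$ for all $\rho\ge 0$, where $D$ is the relative entropy and $I_A(\rho)=\lim_{\delta\to0^+}\mathrm{tr}(A(\rho)\ln(\rho+\delta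 1))$, and $\lambda$-CLSI if $\mathrm{id}_{\mathbb M_k}\otimes A$ satisfies $\lambda$-FLSI for every $k$. The *return time* of $A$ is the infimum of the times $t\ge 0$ with $\|T_t-E_N:L_\infty^1(N\subset\mathbb M_m)\to L_\infty(\mathbb M_m)\|_{cb}\le\frac12$, where $\|x\|_{L_\infty^1(\mathbb M_k(N)\subset\mathbb M_k(\mathbb M_m))}=\sup\|axb\|_1$ over $a,b\in\mathbb M_k(N)$ with $\|a\|_2,\|b\|_2\le 1$. **Theorem.** Let $L$ be a generator, with semigroup $T_t=e^{-tL}$ and fixed-point algebra $N$. Then the set of times defining its return time is non-empty. Let $t_0$ be the maximum of $e$ and the return time of $L$. There is a constant $\alpha(L)>0$ with $$\big(2e\,\ln t_0\,(\ln t_0+\|L\|^2)\big)^{-1}\le\alpha(L)\le\big(2\ln t_0\,(\ln t_0+\|L\|^2)\big)^{-1}$$ such that for every $\varepsilon>0$ there is a generator $B_\varepsilon$ of the form $$B_\varepsilon=\int_0^\infty (I-T_t)\,F_\varepsilon(t)\,\frac{dt}{t},\qquad F_\varepsilon\ge 0,\quad \int_0^\infty\min(1,t)\,F_\varepsilon(t)\,\frac{dt}{t}<\infty,$$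 with $$\|L-B_\varepsilon\|\le\varepsilon\qquad\text{and}\qquad \varepsilon\,\alpha(L)\,\Gamma_{I-E_N}\le\Gamma_{B_\varepsilon}.$$ **Corollary.** The generators satisfying $\lambda$-$\Gamma\mathcal E$ and $\lambda$-CLSI for some $\lambda>0$ are dense in the set of all generators: for every generator $L$ and every $\varepsilon>0$ there are a generator $B$ and $\lambda>0$ with $\|L-B\|<\varepsilon$ such that $B$ satisfies $\lambda$-$\Gamma\mathcal E$ and $\lambda$-CLSI. -/

import Mathlib

open scoped ENNReal Matrix ComplexOrder

noncomputable section

/-- Linear maps on the matrix algebra. -/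
abbrev SuperOp (ι : Type) [Fintype ι] : Type :=
  Matrix ι ι ℂ →ₗ[ℂ] Matrix ι ι ℂ

section Superoperators

variable {ι : Type} [Fintype ι]

/-! ### The Hilbert space `L_2(M_m, tr)` -/

/-- The Hilbert space `L_2(M_m, tr)`: the entries of a matrix with the Euclidean norm. -/
def HS (ι : Type) [Fintype ι] : Type := EuclideanSpace ℂ (ι × ι)

instance : NormedAddCommGroup (HS ι) :=
  inferInstanceAs (NormedAddCommGroup (EuclideanSpace ℂ (ι × ι)))

instance : InnerProductSpace ℂ (HS ι) :=
  inferInstanceAs (InnerProductSpace ℂ (EuclideanSpace ℂ (ι × ι)))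

instance : FiniteDimensional ℂ (HS ι) :=
  inferInstanceAs (FiniteDimensional ℂ (EuclideanSpace ℂ (ι × ι)))

/-- The identification of the matrix algebra with `L_2(M_m, tr)`; the next lemma shows that the
inner product is `⟨x, y⟩ = tr(x^* y)`. -/
def vec : Matrix ι ι ℂ ≃ₗ[ℂ] HS ι where
  toFun x := WithLp.toLp 2 fun p => x p.1 p.2
  invFun v := Matrix.of fun i j => WithLp.ofLp v (i, j)
  left_inv _ := rfl
  right_inv _ := rfl
  map_add' _ _ := rfl
  map_smul' _ _ := rfl

theorem inner_vec (x y : Matrix ι ι ℂ) : inner ℂ (vec x) (vec y) = (xᴴ * y).trace := by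
  have h : inner ℂ (vec x) (vec y) = ∑ p : ι × ι, y p.1 p.2 * star (x p.1 p.2) := by
    change inner ℂ (WithLp.toLp 2 fun p : ι × ι => x p.1 p.2 : EuclideanSpace ℂ (ι × ι))
      (WithLp.toLp 2 fun p : ι × ι => y p.1 p.2 : EuclideanSpace ℂ (ι × ι)) = _
    rw [PiLp.inner_apply]
    rfl
  rw [h, Fintype.sum_prod_type, Finset.sum_comm]
  simp [Matrix.trace, Matrix.mul_apply, mul_comm]

variable [DecidableEq ι]

/-- A linear map on matrices as an operator on `L_2(M_m, tr)`. -/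
def toL2 (A : SuperOp ι) : HS ι →L[ℂ] HS ι :=
  LinearMap.toContinuousLinearMap (vec.toLinearMap ∘ₗ A ∘ₗ vec.symm.toLinearMap)

/-- An operator on `L_2(M_m, tr)` as a linear map on matrices. -/
def ofL2 (S : HS ι →L[ℂ] HS ι) : SuperOp ι :=
  vec.symm.toLinearMap ∘ₗ S.toLinearMap ∘ₗ vec.toLinearMap

/-! ### Semigroups of completely positive maps -/

/-- The `(i, j)` block of a matrix in `M_k ⊗ M = M_k(M)`. -/
def block {k : ℕ} (X : Matrix (Fin k × ι) (Fin k × ι) ℂ) (i j : Fin k) : Matrix ι ι ℂ :=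
  Matrix.of fun p q => X (i, p) (j, q)

/-- The amplification `id_{M_k} ⊗ Φ`, which applies `Φ` to every block. -/
def amplify (k : ℕ) (Φ : SuperOp ι) : SuperOp (Fin k × ι) where
  toFun X := Matrix.of fun p q => Φ (block X p.1 q.1) p.2 q.2
  map_add' X Y := by
    ext p q
    have h : block (X + Y) p.1 q.1 = block X p.1 q.1 + block Y p.1 q.1 := rfl
    simp [h]
  map_smul' c X := by
    ext p q
    have h : block (c • X) p.1 q.1 = c • block X p.1 q.1 := rfl
    simp [h]

/-- Complete positivity: all amplifications preserve positive semidefinite matrices. -/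
def IsCompletelyPositive (Φ : SuperOp ι) : Prop :=
  ∀ (k : ℕ) (X : Matrix (Fin k × ι) (Fin k × ι) ℂ), X.PosSemidef → (amplify k Φ X).PosSemidef

theorem nonneg_iff_star_mul {B : Type*} [NonUnitalCStarAlgebra B] [PartialOrder B] [StarOrderedRing B] (M : B) :
   0 ≤ M ↔ ∃ s, M = star s * s := CStarAlgebra.nonneg_iff_eq_star_mul_self

open scoped Matrix.Norms.L2Operator MatrixOrder in
theorem posSemidef_iff_conjTranspose_mul {κ : Type} [Fintype κ] [DecidableEq κ] (M : Matrix κ κ ℂ) : M.PosSemidef ↔ ∃ s, M = sᴴ * s := by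
  rw [← Matrix.nonneg_iff_posSemidef]
  exact CStarAlgebra.nonneg_iff_eq_star_mul_self

open scoped Matrix.Norms.L2Operator MatrixOrder CStarAlgebra in
/-- The definition agrees with Mathlib's `CompletelyPositiveMap`. -/
theorem isCompletelyPositive_iff (Φ : SuperOp ι) :
    IsCompletelyPositive Φ ↔ ∃ Ψ : Matrix ι ι ℂ →CP Matrix ι ι ℂ, Ψ.toLinearMap = Φ := by
  have key : ∀ (k : ℕ) (M : CStarMatrix (Fin k) (Fin k) (Matrix ι ι ℂ)),
      0 ≤ M ↔ (Matrix.of fun p q : Fin k × ι => M p.1 q.1 p.2 q.2).PosSemidef := by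
    intro k M
    rw [nonneg_iff_star_mul, posSemidef_iff_conjTranspose_mul]
    constructor
    · rintro ⟨s, rfl⟩
      refine ⟨Matrix.of fun p q => s p.1 q.1 p.2 q.2, ?_⟩
      ext p q
      simp [CStarMatrix.mul_apply, Matrix.mul_apply, Matrix.sum_apply, Fintype.sum_prod_type,
        CStarMatrix.star_apply]
    · rintro ⟨S, hS⟩
      refine ⟨CStarMatrix.ofMatrix (Matrix.of fun i j => block S i j), ?_⟩
      ext i j p q
      have := congrFun (congrFun hS (i, p)) (j, q)
      simp [CStarMatrix.mul_apply, Matrix.mul_apply, Matrix.sum_apply, Fintype.sum_prod_type,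
        CStarMatrix.star_apply, block] at this ⊢
      exact this
  constructor
  · intro h
    refine ⟨{ toLinearMap := Φ, map_cstarMatrix_nonneg' := ?_ }, rfl⟩
    intro k M hM
    rw [key] at hM ⊢
    exact h k _ hM
  · rintro ⟨Ψ, rfl⟩ k X hX
    have := Ψ.map_cstarMatrix_nonneg' k (CStarMatrix.ofMatrix (Matrix.of fun i j => block X i j))
    rw [key, key] at this
    exact this hX

/-- The semigroup `T_t = e^{-tA}`. -/
def semigroup (A : SuperOp ι) (t : ℝ) : SuperOp ι :=
  ofL2 (NormedSpace.exp ((-t : ℂ) • toL2 A))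

/-- `A` generates a semigroup `e^{-tA}` of unital completely positive maps which are self-adjoint
on `L_2(M_m, tr)`. -/
def IsGenerator (A : SuperOp ι) : Prop :=
  ∀ t : ℝ, 0 ≤ t →
    IsCompletelyPositive (semigroup A t) ∧ semigroup A t 1 = 1 ∧ IsSelfAdjoint (toL2 (semigroup A t))

/-- The fixed-point algebra `N = {x | T_t x = x for all t ≥ 0}`, as a linear subspace. -/
def fixedPoints (A : SuperOp ι) : Submodule ℂ (Matrix ι ι ℂ) where
  carrier := {x | ∀ t : ℝ, 0 ≤ t → semigroup A t x = x}
  add_mem' := by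
    intro x y hx hy t ht
    rw [map_add, hx t ht, hy t ht]
  zero_mem' := by
    intro t _
    exact map_zero _
  smul_mem' := by
    intro c x hx t ht
    rw [map_smul, hx t ht]

/-- The trace-preserving conditional expectation `E_N` onto the fixed-point algebra `N` of
`e^{-tA}`: the orthogonal projection of `L_2(M_m, tr)` onto `N`. -/
def fixedExp (A : SuperOp ι) : SuperOp ι :=
  ofL2 ((fixedPoints A).map vec.toLinearMap).starProjection

/-! ### Gradient forms -/

/-- `Γ_A(x, y) = ½ (A(x)^* y + x^* A(y) - A(x^* y))`. -/
def gradForm (A : SuperOp ι) (x y : Matrix ι ι ℂ) : Matrix ι ι ℂ :=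
  (1 / 2 : ℂ) • ((A x)ᴴ * y + xᴴ * A y - A (xᴴ * y))

/-- `c Γ_A ≤_cp Γ_B`: for every matrix `(x_{ij})` over `M`, the inequality
`c [∑_l Γ_A(x_{li}, x_{lj})]_{ij} ≤ [∑_l Γ_B(x_{li}, x_{lj})]_{ij}` holds in `M_k(M)`. -/
def GradLE (c : ℝ) (A B : SuperOp ι) : Prop :=
  ∀ (k : ℕ) (x : Fin k → Fin k → Matrix ι ι ℂ),
    (Matrix.of fun p q : Fin k × ι =>
      (∑ l, (gradForm B (x l p.1) (x l q.1) - (c : ℂ) • gradForm A (x l p.1) (x l q.1)))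
        p.2 q.2).PosSemidef

/-- The gradient condition `lam`-ΓE: `lam Γ_{I - E_N} ≤_cp Γ_A`. -/
def GammaE (lam : ℝ) (A : SuperOp ι) : Prop :=
  GradLE lam (LinearMap.id - fixedExp A) A

/-! ### Entropy inequalities

They do not depend on the normalization of the trace. -/

/-- Relative entropy `D(ρ‖σ) = tr(ρ ln ρ) - tr(ρ ln σ)` for `ρ, σ ≥ 0` with `ker σ ⊆ ker ρ`, and
`+∞` otherwise. The convention `Real.log 0 = 0` gives `0 ln 0 = 0`, and in the first case the
value of `ln σ` on `ker σ` is irrelevant. -/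
def relEntropy (ρ σ : Matrix ι ι ℂ) : EReal :=
  open Classical in
  if ∀ v : ι → ℂ, σ *ᵥ v = 0 → ρ *ᵥ v = 0 then
    ((((ρ * cfc Real.log ρ).trace - (ρ * cfc Real.log σ).trace).re : ℝ) : EReal)
  else ⊤

/-- Fisher information `I_A(ρ) = lim_{ε → 0+} tr(A(ρ) ln(ρ + ε))`, in `(-∞, +∞]`. -/
def fisherInfo (A : SuperOp ι) (ρ : Matrix ι ι ℂ) : EReal :=
  Filter.liminf
    (fun ε : ℝ => (((A ρ * cfc Real.log (ρ + (ε : ℂ) • (1 : Matrix ι ι ℂ))).trace.re : ℝ) : EReal))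
    (nhdsWithin 0 (Set.Ioi 0))

/-- `lam`-FLSI: `lam D(ρ‖E_N(ρ)) ≤ I_A(ρ)` for all `ρ ≥ 0`. -/
def FLSI (lam : ℝ) (A : SuperOp ι) : Prop :=
  ∀ ρ : Matrix ι ι ℂ, ρ.PosSemidef →
    (lam : EReal) * relEntropy ρ (fixedExp A ρ) ≤ fisherInfo A ρ

/-- `lam`-CLSI: every amplification satisfies `lam`-FLSI. -/
def CLSI (lam : ℝ) (A : SuperOp ι) : Prop :=
  ∀ k : ℕ, FLSI lam (amplify k A)

/-! ### Return time -/

/-- The Schatten 1-norm: the sum of the singular values. -/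
def traceNorm (X : Matrix ι ι ℂ) : ℝ :=
  ∑ i, √((Matrix.isHermitian_conjTranspose_mul_self X).eigenvalues i)

/-- The norm of `L_∞^1(M_k(N) ⊂ M_k(M))`: the supremum of `‖a X b‖_1` over `a, b` in the unit
ball of `L_2(M_k(N))`. It does not depend on the normalization of the trace. -/
def mixedNorm (N : Submodule ℂ (Matrix ι ι ℂ)) {k : ℕ}
    (X : Matrix (Fin k × ι) (Fin k × ι) ℂ) : ℝ≥0∞ :=
  ⨆ (a : Matrix (Fin k × ι) (Fin k × ι) ℂ) (b : Matrix (Fin k × ι) (Fin k × ι) ℂ)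
    (_ : (∀ i j, block a i j ∈ N) ∧ ‖vec a‖ ≤ 1) (_ : (∀ i j, block b i j ∈ N) ∧ ‖vec b‖ ≤ 1),
    ENNReal.ofReal (traceNorm (a * X * b))

/-- The completely bounded norm `‖Φ : L_∞^1(N ⊂ M) → L_∞(M)‖_cb`; the norm of `L_∞(M_k(M))` is the
operator norm on `ℓ_2`. -/
def cbNormOneInf (N : Submodule ℂ (Matrix ι ι ℂ)) (Φ : SuperOp ι) : ℝ≥0∞ :=
  ⨆ (k : ℕ) (X : Matrix (Fin k × ι) (Fin k × ι) ℂ) (_ : mixedNorm N X ≤ 1),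
    ENNReal.ofReal ‖Matrix.toEuclideanCLM (𝕜 := ℂ) (amplify k Φ X)‖

/-- The times at which `‖T_t - E_N : L_∞^1(N ⊂ M) → L_∞(M)‖_cb ≤ 1/2`. -/
def returnTimes (A : SuperOp ι) : Set ℝ :=
  {t | 0 ≤ t ∧ cbNormOneInf (fixedPoints A) (semigroup A t - fixedExp A) ≤ 1 / 2}

/-- The return time of `A`. -/
def returnTime (A : SuperOp ι) : ℝ := sInf (returnTimes A)

/-! ### Functional calculus -/

/-- `B = Φ_F(A) = ∫_0^∞ (I - T_t) F(t) dt/t` for a function `F ≥ 0` with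
`∫_0^∞ min(1, t) F(t) dt/t < ∞`. -/
def IsSubordinated (A B : SuperOp ι) (F : ℝ → ℝ) : Prop :=
  (∀ t, 0 < t → 0 ≤ F t) ∧
  MeasureTheory.IntegrableOn (fun t => min 1 t * F t / t) (Set.Ioi 0) ∧
  ∀ x : Matrix ι ι ℂ,
    vec (B x) = ∫ t in Set.Ioi (0 : ℝ), (F t / t) • vec (x - semigroup A t x)

end Superoperators

end

/-!
For a generator `L` with semigroup `T_t`, fixed-point algebra `N` and conditional expectation `E_N`,
the perturbation is
`B = (2/δ²) ∫_0^δ (I - T_t) dt + c ∫_s^{s+1} (I - T_t) dt`,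
where `s` is a time with `‖T_s - E_N : L_∞^1(N ⊂ M) → L_∞(M)‖_cb ≤ 1/2`. The first integral tends to
`L` as `δ → 0` (`exists_norm_sub_average_le`), and the second one has norm at most `2c`, since the
`T_t` are contractions of `L_2`.

Such times exist because `T_t → E_N` (`tendsto_semigroup`) and the completely bounded norm is bounded
by matrix entries (`cbNormOneInf_le`). From time `s` on the map `T_t - E_N / 2` is completely positive
(`isCompletelyPositive_semigroup_sub`): for `X ≥ 0` in `M_k(M)` and `σ = E_N(X) + δ`, the matrix
`Y = σ^{-1/2} X σ^{-1/2}` lies in the unit ball of `L_∞^1(N ⊂ M)`, so `(T_s - E_N)(Y) ≥ -1/2`, and the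
factors `σ^{-1/2} ∈ M_k(N)` can be moved out because `T_s` and `E_N` are `N`-bimodule maps. Hence
`B = (c/2) (I - E_N) + (κ I - Ψ)` with `Ψ` completely positive, symmetric and `Ψ(1) = κ 1`
(`exists_subordinated_generator`). Everything else follows from this decomposition.

* The gradient form of `κ I - Ψ` is a sum of squares of commutators with the Kraus operators of `Ψ`,
  so that `(c/2) Γ_{I - E_N} ≤ Γ_B` (`gradLE_of_completelyPositive`). With `c = 2 ε α` the norm of the
  perturbation allows every `α ≤ 3/16`, and the lower end `(2 e ln t₀ (ln t₀ + ‖L‖²))⁻¹` of the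
  required range is such a value because `ln t₀ ≥ 1`.
* The entropy production of `κ I - Ψ`, and of all its amplifications, is nonnegative
  (`entropyProduction_nonneg`), while that of `I - E_N` dominates `D(ρ‖E_N(ρ))` by Klein's inequality
  (`re_trace_mul_log_le`). This gives CLSI (`clsi_of_decomposition`), once it is known that `B` and `L`
  have the same fixed points (`fixedPoints_eq_of_decomposition`).
-/

section Basics

variable {ι : Type}

/-! ### Block matrices -/

theorem ext_block {k : ℕ} {X Y : Matrix (Fin k × ι) (Fin k × ι) ℂ}
    (h : ∀ i j, block X i j = block Y i j) : X = Y := by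
  ext ⟨i, p⟩ ⟨j, q⟩
  exact congrFun (congrFun (h i j) p) q

theorem block_conjTranspose {k : ℕ} (X : Matrix (Fin k × ι) (Fin k × ι) ℂ) (i j : Fin k) :
    block Xᴴ i j = (block X j i)ᴴ := rfl

theorem block_smul {k : ℕ} (c : ℂ) (X : Matrix (Fin k × ι) (Fin k × ι) ℂ) (i j : Fin k) :
    block (c • X) i j = c • block X i j := rfl

theorem block_one [DecidableEq ι] {k : ℕ} (i j : Fin k) :
    block (1 : Matrix (Fin k × ι) (Fin k × ι) ℂ) i j = if i = j then 1 else 0 := by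
  ext p q
  by_cases h : i = j <;> simp [block, Matrix.one_apply, h]

variable [Fintype ι]

/-! ### Superoperators as operators on `L_2` -/

theorem norm_vec_sq (x : Matrix ι ι ℂ) : ‖vec x‖ ^ 2 = (xᴴ * x).trace.re := by
  rw [← inner_vec, ← inner_self_eq_norm_sq (𝕜 := ℂ)]
  rfl

theorem norm_vec_sq_coe (x : Matrix ι ι ℂ) : ((‖vec x‖ ^ 2 : ℝ) : ℂ) = (xᴴ * x).trace := by
  rw [← inner_vec, inner_self_eq_norm_sq_to_K]
  norm_cast

theorem norm_vec_conjTranspose (x : Matrix ι ι ℂ) : ‖vec xᴴ‖ = ‖vec x‖ := by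
  rw [← sq_eq_sq₀ (norm_nonneg _) (norm_nonneg _), norm_vec_sq, norm_vec_sq,
    Matrix.conjTranspose_conjTranspose, Matrix.trace_mul_comm]

@[simp] theorem toL2_vec (A : SuperOp ι) (x : Matrix ι ι ℂ) : toL2 A (vec x) = vec (A x) := rfl

@[simp] theorem vec_ofL2 (S : HS ι →L[ℂ] HS ι) (x : Matrix ι ι ℂ) :
    vec (ofL2 S x) = S (vec x) := rfl

@[simp] theorem toL2_ofL2 (S : HS ι →L[ℂ] HS ι) : toL2 (ofL2 S) = S := by ext v; rfl

@[simp] theorem ofL2_toL2 (A : SuperOp ι) : ofL2 (toL2 A) = A := by ext v; rfl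

theorem toL2_sub (A B : SuperOp ι) : toL2 (A - B) = toL2 A - toL2 B := rfl

theorem toL2_add (A B : SuperOp ι) : toL2 (A + B) = toL2 A + toL2 B := rfl

theorem toL2_smul (c : ℂ) (A : SuperOp ι) : toL2 (c • A) = c • toL2 A := rfl

theorem toL2_id : toL2 (LinearMap.id : SuperOp ι) = 1 := rfl

theorem toL2_comp (A B : SuperOp ι) : toL2 (A ∘ₗ B) = toL2 A * toL2 B := rfl

theorem toL2_injective : Function.Injective (toL2 : SuperOp ι → HS ι →L[ℂ] HS ι) :=
  fun A B h => by rw [← ofL2_toL2 A, h, ofL2_toL2]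

/-- Self-adjointness on `L_2` in terms of the trace pairing. -/
theorem isSelfAdjoint_toL2_iff (A : SuperOp ι) :
    IsSelfAdjoint (toL2 A) ↔ ∀ x y, ((A x)ᴴ * y).trace = (xᴴ * A y).trace := by
  rw [ContinuousLinearMap.isSelfAdjoint_iff_isSymmetric]
  constructor
  · intro h x y
    rw [← inner_vec, ← inner_vec]
    exact h (vec x) (vec y)
  · intro h v w
    obtain ⟨x, rfl⟩ := vec.surjective v
    obtain ⟨y, rfl⟩ := vec.surjective w
    change inner ℂ (vec (A x)) (vec y) = inner ℂ (vec x) (vec (A y))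
    rw [inner_vec, inner_vec, h]

/-! ### Amplifications -/

theorem amplify_apply (k : ℕ) (Φ : SuperOp ι) (X : Matrix (Fin k × ι) (Fin k × ι) ℂ) (p q) :
    amplify k Φ X p q = Φ (block X p.1 q.1) p.2 q.2 := rfl

@[simp] theorem block_amplify (k : ℕ) (Φ : SuperOp ι) (X : Matrix (Fin k × ι) (Fin k × ι) ℂ) (i j) :
    block (amplify k Φ X) i j = Φ (block X i j) := rfl

theorem block_mul {k : ℕ} (X Y : Matrix (Fin k × ι) (Fin k × ι) ℂ) (i j : Fin k) :
    block (X * Y) i j = ∑ l, block X i l * block Y l j := by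
  ext p q
  simp [block, Matrix.mul_apply, Fintype.sum_prod_type, Matrix.sum_apply]

theorem trace_eq_sum_block {k : ℕ} (X : Matrix (Fin k × ι) (Fin k × ι) ℂ) :
    X.trace = ∑ i, (block X i i).trace := by
  simp [Matrix.trace, Fintype.sum_prod_type, block]

theorem amplify_add (k : ℕ) (Φ Ψ : SuperOp ι) :
    amplify k (Φ + Ψ) = amplify k Φ + amplify k Ψ := rfl

theorem amplify_sub (k : ℕ) (Φ Ψ : SuperOp ι) :
    amplify k (Φ - Ψ) = amplify k Φ - amplify k Ψ := rfl

theorem amplify_smul (k : ℕ) (c : ℂ) (Φ : SuperOp ι) :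
    amplify k (c • Φ) = c • amplify k Φ := rfl

theorem amplify_id (k : ℕ) : amplify k (LinearMap.id : SuperOp ι) = LinearMap.id := rfl

theorem isSelfAdjoint_toL2_amplify {Φ : SuperOp ι} (h : IsSelfAdjoint (toL2 Φ)) (k : ℕ) :
    IsSelfAdjoint (toL2 (amplify k Φ)) := by
  rw [isSelfAdjoint_toL2_iff] at h ⊢
  intro X Y
  simp only [trace_eq_sum_block, block_mul, block_conjTranspose, block_amplify, Matrix.trace_sum, h]

theorem IsCompletelyPositive.comp {Φ Ψ : SuperOp ι} (h : IsCompletelyPositive Φ)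
    (h' : IsCompletelyPositive Ψ) : IsCompletelyPositive (Φ ∘ₗ Ψ) :=
  fun k X hX => h k _ (h' k X hX)

/-! ### The semigroup -/

theorem toL2_semigroup (A : SuperOp ι) (t : ℝ) :
    toL2 (semigroup A t) = NormedSpace.exp (t • (-toL2 A)) := by
  rw [semigroup, toL2_ofL2]
  congr 1
  ext v
  simp

theorem semigroup_zero (A : SuperOp ι) : semigroup A 0 = LinearMap.id := by
  apply toL2_injective
  rw [toL2_semigroup, zero_smul, NormedSpace.exp_zero, toL2_id]

theorem semigroup_add (A : SuperOp ι) (s t : ℝ) :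
    semigroup A (s + t) = semigroup A s ∘ₗ semigroup A t := by
  let := NormedAlgebra.restrictScalars ℚ ℂ (HS ι →L[ℂ] HS ι)
  apply toL2_injective
  rw [toL2_comp, toL2_semigroup, toL2_semigroup, toL2_semigroup, add_smul,
    NormedSpace.exp_add_of_commute]
  exact ((Commute.refl _).smul_left s).smul_right t

theorem hasDerivAt_semigroup (A : SuperOp ι) (t : ℝ) :
    HasDerivAt (fun t : ℝ => toL2 (semigroup A t)) (toL2 (semigroup A t) * (-toL2 A)) t := by
  simp_rw [toL2_semigroup]
  exact hasDerivAt_exp_smul_const (𝕂 := ℝ) (-toL2 A) t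

theorem continuous_semigroup (A : SuperOp ι) :
    Continuous (fun t : ℝ => toL2 (semigroup A t)) :=
  continuous_iff_continuousAt.2 fun t => (hasDerivAt_semigroup A t).continuousAt

theorem hasDerivAt_semigroup_zero (A : SuperOp ι) :
    HasDerivAt (fun t : ℝ => toL2 (semigroup A t)) (-toL2 A) 0 := by
  have h := hasDerivAt_semigroup A 0
  rwa [semigroup_zero, toL2_id, one_mul] at h

theorem semigroup_apply_of_eq_zero {A : SuperOp ι} {x : Matrix ι ι ℂ} (hx : A x = 0) (t : ℝ) :
    semigroup A t x = x := by
  have hd : ∀ t : ℝ, HasDerivAt (fun t : ℝ => toL2 (semigroup A t) (vec x)) 0 t := by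
    intro t
    have h := ((ContinuousLinearMap.apply ℂ (HS ι) (vec x)).restrictScalars ℝ).hasFDerivAt
      |>.comp_hasDerivAt
      t (hasDerivAt_semigroup A t)
    have h0 : (toL2 (semigroup A t) * (-toL2 A)) (vec x) = 0 := by
      simp [hx]
    have h1 : ((ContinuousLinearMap.apply ℂ (HS ι) (vec x)).restrictScalars ℝ)
      (toL2 (semigroup A t) * (-toL2 A)) = 0 := h0
    rw [h1] at h
    exact h
  have := is_const_of_deriv_eq_zero (fun t => (hd t).differentiableAt) (fun t => (hd t).deriv) t 0
  apply vec.injective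
  simpa [semigroup_zero] using this

theorem mem_fixedPoints_iff {A : SuperOp ι} {x : Matrix ι ι ℂ} :
    x ∈ fixedPoints A ↔ A x = 0 := by
  refine ⟨fun h => ?_, fun h t _ => semigroup_apply_of_eq_zero h t⟩
  have hd := ((ContinuousLinearMap.apply ℂ (HS ι) (vec x)).restrictScalars ℝ).hasFDerivAt
      |>.comp_hasDerivAt
      0 (hasDerivAt_semigroup_zero A)
  have hd' : HasDerivWithinAt (fun t : ℝ => toL2 (semigroup A t) (vec x)) (-vec (A x))
      (Set.Ici 0) 0 := HasDerivAt.hasDerivWithinAt hd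
  have hc : HasDerivWithinAt (fun t : ℝ => toL2 (semigroup A t) (vec x)) 0 (Set.Ici 0) 0 := by
    refine (hasDerivWithinAt_const (0 : ℝ) (Set.Ici 0) (vec x)).congr_of_mem ?_ (by simp)
    intro t ht
    rw [toL2_vec, h t ht]
  have := (uniqueDiffWithinAt_Ici (0 : ℝ)).eq_deriv _ hd' hc
  apply vec.injective
  simpa using this

/-! ### Completely positive maps -/

variable [DecidableEq ι]

theorem amplify_one {k : ℕ} {Φ : SuperOp ι} {c : ℂ} (h : Φ 1 = c • 1) :
    amplify k Φ 1 = c • 1 := by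
  apply ext_block
  intro i j
  rw [block_amplify, block_smul, block_one]
  split_ifs <;> simp [h]

/-- A completely positive map has a Kraus decomposition, read off from its Choi matrix. -/
theorem IsCompletelyPositive.exists_kraus {Φ : SuperOp ι} (h : IsCompletelyPositive Φ) :
    ∃ K : Fin (Fintype.card ι) × ι → Matrix ι ι ℂ, ∀ x, Φ x = ∑ r, (K r)ᴴ * x * K r := by
  let e := Fintype.equivFin ι
  let w : Fin (Fintype.card ι) × ι → ℂ := fun p => if p.2 = e.symm p.1 then 1 else 0
  have hC := h _ _ (Matrix.posSemidef_vecMulVec_self_star w)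
  obtain ⟨S, hS⟩ := (posSemidef_iff_conjTranspose_mul _).1 hC
  refine ⟨fun r => Matrix.of fun j q => S r (e j, q), fun x => ?_⟩
  have hb : ∀ i j : ι, block (Matrix.vecMulVec w (star w)) (e i) (e j) = Matrix.single i j 1 := by
    intro i j
    ext p q
    simp only [block, Matrix.vecMulVec_apply, Matrix.of_apply, w, Pi.star_apply,
      Equiv.symm_apply_apply, Matrix.single_apply]
    by_cases h1 : i = p <;> by_cases h2 : j = q <;>
      simp [h1, h2, eq_comm (a := p), eq_comm (a := q)]
  have hΦ : ∀ i j p q, Φ (Matrix.single i j 1) p q = ∑ r, star (S r (e i, p)) * S r (e j, q) := by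
    intro i j p q
    have := congrFun (congrFun hS (e i, p)) (e j, q)
    rw [amplify_apply, hb] at this
    rw [this, Matrix.mul_apply]
    rfl
  have hx : x = ∑ i, ∑ j, x i j • Matrix.single i j (1 : ℂ) := by
    conv_lhs => rw [Matrix.matrix_eq_sum_single x]
    simp [Matrix.smul_single]
  ext p q
  conv_lhs => rw [hx]
  simp only [map_sum, map_smul, Matrix.sum_apply, Matrix.smul_apply, hΦ, Matrix.mul_apply,
    Matrix.conjTranspose_apply, Matrix.of_apply, Finset.sum_mul, Finset.mul_sum, smul_eq_mul]
  rw [Finset.sum_comm]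
  simp only [Finset.sum_comm (γ := ι) (α := Fin (Fintype.card ι) × ι)]
  refine Finset.sum_congr rfl fun r _ => ?_
  refine Finset.sum_congr rfl fun j _ => Finset.sum_congr rfl fun i _ => ?_
  ring

theorem IsCompletelyPositive.map_conjTranspose {Φ : SuperOp ι} (h : IsCompletelyPositive Φ)
    (x : Matrix ι ι ℂ) : Φ xᴴ = (Φ x)ᴴ := by
  obtain ⟨K, hK⟩ := h.exists_kraus
  simp [hK, Matrix.conjTranspose_sum, Matrix.mul_assoc]

/-- The gradient form of a completely positive map is a sum of squares of commutators. -/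
theorem kraus_gradient {κ : Type*} [Fintype κ] {Φ : SuperOp ι} {K : κ → Matrix ι ι ℂ}
    (hK : ∀ x, Φ x = ∑ r, (K r)ᴴ * x * K r) (x y : Matrix ι ι ℂ) :
    xᴴ * Φ 1 * y - (Φ xᴴ) * y - xᴴ * Φ y + Φ (xᴴ * y)  =
      ∑ r, (x * K r - K r * x)ᴴ * (y * K r - K r * y) := by
  simp only [hK, Finset.mul_sum, Finset.sum_mul, ← Finset.sum_sub_distrib, ← Finset.sum_add_distrib]
  refine Finset.sum_congr rfl fun r _ => ?_
  simp only [Matrix.conjTranspose_sub, Matrix.conjTranspose_mul]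
  noncomm_ring

/-- If `B - c A = κ I - Ψ` with `Ψ` completely positive and `Ψ(1) = κ 1`, then `c Γ_A ≤ Γ_B`. -/
theorem gradLE_of_completelyPositive {c : ℝ} {κ : ℂ} {A B Ψ : SuperOp ι}
    (hΨ : IsCompletelyPositive Ψ) (h1 : Ψ 1 = κ • 1)
    (h : B = (c : ℂ) • A + (κ • LinearMap.id - Ψ)) : GradLE c A B := by
  obtain ⟨K, hK⟩ := hΨ.exists_kraus
  intro k x
  have hG : ∀ x y : Matrix ι ι ℂ, gradForm B x y - (c : ℂ) • gradForm A x y =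
      (1 / 2 : ℂ) • ∑ r, (x * K r - K r * x)ᴴ * (y * K r - K r * y) := by
    intro x y
    rw [← kraus_gradient hK, h1, hΨ.map_conjTranspose]
    have hκ : star κ • (xᴴ * y) = κ • (xᴴ * y) := by
      have := hΨ.map_conjTranspose 1
      rw [Matrix.conjTranspose_one, h1, Matrix.conjTranspose_smul, Matrix.conjTranspose_one] at this
      calc star κ • (xᴴ * y) = xᴴ * ((star κ • (1 : Matrix ι ι ℂ)) * y) := by simp
        _ = _ := by rw [← this]; simp
    simp only [gradForm, h, LinearMap.add_apply, LinearMap.smul_apply, LinearMap.sub_apply,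
      LinearMap.id_apply, Matrix.conjTranspose_add, Matrix.conjTranspose_sub,
      Matrix.conjTranspose_smul, add_mul, sub_mul, mul_add, mul_sub, Matrix.smul_mul,
      Matrix.mul_smul, Matrix.mul_one, Complex.star_def, Complex.conj_ofReal]
    simp only [Complex.star_def] at hκ
    rw [hκ]
    module
  simp only [hG]
  have key : (Matrix.of fun p q : Fin k × ι => (∑ l, (1 / 2 : ℂ) • ∑ r,
      (x l p.1 * K r - K r * x l p.1)ᴴ * (x l q.1 * K r - K r * x l q.1)) p.2 q.2) =
      ∑ l, (1 / 2 : ℂ) • ∑ r,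
        (Matrix.of fun a (q : Fin k × ι) => (x l q.1 * K r - K r * x l q.1) a q.2)ᴴ *
        (Matrix.of fun a (q : Fin k × ι) => (x l q.1 * K r - K r * x l q.1) a q.2) := by
    ext p q
    simp only [Matrix.of_apply, Matrix.sum_apply, Matrix.smul_apply, Matrix.mul_apply (M := _ᴴ),
      Matrix.conjTranspose_apply]
  rw [key]
  refine Matrix.posSemidef_sum _ fun l _ => Matrix.PosSemidef.smul ?_ (one_div_nonneg.2 zero_le_two)
  exact Matrix.posSemidef_sum _ fun r _ => Matrix.posSemidef_conjTranspose_mul_self _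

end Basics

section Cone

variable {ι : Type} [Fintype ι]

/-! ### The closed cone of completely positive maps -/

/-- The linear functional `S ↦ ⟨v, (id_{M_k} ⊗ S)(X) v⟩` on operators. Complete positivity of `S`
means that these are nonnegative for `X ≥ 0`, hence it passes to integrals, exponentials and
limits. -/
noncomputable def cpFunctional (k : ℕ) (X : Matrix (Fin k × ι) (Fin k × ι) ℂ) (v : Fin k × ι → ℂ) :
    (HS ι →L[ℂ] HS ι) →L[ℂ] ℂ :=
  LinearMap.toContinuousLinearMap
    { toFun := fun S => star v ⬝ᵥ (amplify k (ofL2 S) X *ᵥ v)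
      map_add' := fun S T => by
        have h : amplify k (ofL2 (S + T)) X = amplify k (ofL2 S) X + amplify k (ofL2 T) X := rfl
        rw [h, Matrix.add_mulVec, dotProduct_add]
      map_smul' := fun c S => by
        have h : amplify k (ofL2 (c • S)) X = c • amplify k (ofL2 S) X := rfl
        rw [h, Matrix.smul_mulVec, dotProduct_smul]
        rfl }

theorem cpFunctional_apply (k : ℕ) (X : Matrix (Fin k × ι) (Fin k × ι) ℂ) (v : Fin k × ι → ℂ)
    (S : HS ι →L[ℂ] HS ι) :
    cpFunctional k X v S = star v ⬝ᵥ (amplify k (ofL2 S) X *ᵥ v) := rfl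

/-- Over `ℂ`, nonnegativity of the quadratic form implies that a matrix is Hermitian. -/
theorem posSemidef_iff_forall_dotProduct {n : Type} [Fintype n] {M : Matrix n n ℂ} :
    M.PosSemidef ↔ ∀ v : n → ℂ, 0 ≤ star v ⬝ᵥ (M *ᵥ v) := by
  classical
  refine ⟨fun h v => h.dotProduct_mulVec_nonneg v, fun h => ?_⟩
  rw [← Matrix.isPositive_toEuclideanLin_iff, LinearMap.isPositive_iff_complex]
  intro x
  have h1 : inner ℂ (M.toEuclideanLin x) x =
      star (star (WithLp.ofLp x) ⬝ᵥ (M *ᵥ WithLp.ofLp x)) := by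
    rw [EuclideanSpace.inner_eq_star_dotProduct, Matrix.star_dotProduct]
    rw [dotProduct_comm]
    simp [Matrix.toLpLin_apply]
  have h2 := Complex.nonneg_iff.1 (h (WithLp.ofLp x))
  rw [h1]
  refine ⟨?_, ?_⟩
  · apply Complex.ext <;> simp [← h2.2]
  · simpa using h2.1

theorem isCompletelyPositive_ofL2_iff (S : HS ι →L[ℂ] HS ι) :
    IsCompletelyPositive (ofL2 S) ↔
      ∀ (k : ℕ) (X : Matrix (Fin k × ι) (Fin k × ι) ℂ), X.PosSemidef → ∀ v,
        0 ≤ cpFunctional k X v S := by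
  simp only [cpFunctional_apply, ← posSemidef_iff_forall_dotProduct]
  rfl

theorem isClosed_completelyPositive :
    IsClosed {S : HS ι →L[ℂ] HS ι | IsCompletelyPositive (ofL2 S)} := by
  simp only [isCompletelyPositive_ofL2_iff, Set.ofPred_forall]
  refine isClosed_iInter fun k => isClosed_iInter fun X => isClosed_iInter fun _ =>
    isClosed_iInter fun v => ?_
  exact isClosed_Ici.preimage (cpFunctional k X v).continuous

theorem IsCompletelyPositive.add {Φ Ψ : SuperOp ι} (h : IsCompletelyPositive Φ)
    (h' : IsCompletelyPositive Ψ) : IsCompletelyPositive (Φ + Ψ) :=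
  fun k X hX => (h k X hX).add (h' k X hX)

theorem IsCompletelyPositive.smul {Φ : SuperOp ι} (h : IsCompletelyPositive Φ) {c : ℝ}
    (hc : 0 ≤ c) : IsCompletelyPositive ((c : ℂ) • Φ) :=
  fun k X hX => (h k X hX).smul (Complex.zero_le_real.2 hc)

theorem isCompletelyPositive_integral {μ : MeasureTheory.Measure ℝ} {f : ℝ → HS ι →L[ℂ] HS ι}
    (hf : MeasureTheory.Integrable f μ) (h : ∀ᵐ t ∂μ, IsCompletelyPositive (ofL2 (f t))) :
    IsCompletelyPositive (ofL2 (∫ t, f t ∂μ)) := by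
  rw [isCompletelyPositive_ofL2_iff]
  intro k X hX v
  rw [← ContinuousLinearMap.integral_comp_comm _ hf]
  refine MeasureTheory.integral_nonneg_of_ae (h.mono fun t ht => ?_)
  exact (isCompletelyPositive_ofL2_iff _).1 ht k X hX v

theorem isCompletelyPositive_id : IsCompletelyPositive (LinearMap.id : SuperOp ι) :=
  fun _ _ hX => hX

theorem isCompletelyPositive_exp {Q : HS ι →L[ℂ] HS ι} (h : IsCompletelyPositive (ofL2 Q)) :
    IsCompletelyPositive (ofL2 (NormedSpace.exp Q)) := by
  have hp : ∀ n : ℕ, IsCompletelyPositive (ofL2 (Q ^ n)) := by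
    intro n
    induction n with
    | zero => exact isCompletelyPositive_id
    | succ n ih =>
      have h' : ofL2 (Q ^ (n + 1)) = ofL2 (Q ^ n) ∘ₗ ofL2 Q := by rw [pow_succ]; rfl
      rw [h']
      exact ih.comp h
  rw [isCompletelyPositive_ofL2_iff]
  intro k X hX v
  have hs := (NormedSpace.expSeries_hasSum_exp (𝕂 := ℂ) Q).mapL (cpFunctional k X v)
  refine hs.nonneg fun n => ?_
  rw [NormedSpace.expSeries_apply_eq, map_smul, smul_eq_mul]
  refine mul_nonneg ?_ ((isCompletelyPositive_ofL2_iff _).1 (hp n) k X hX v)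
  rw [inv_nonneg]
  exact Nat.cast_nonneg _

/-! ### Generators of the form `κ I - Ψ` -/

theorem semigroup_add_smul_id (A : SuperOp ι) (c : ℂ) (t : ℝ) :
    semigroup (A + c • LinearMap.id) t = Complex.exp (-t * c) • semigroup A t := by
  let := NormedAlgebra.restrictScalars ℚ ℂ (HS ι →L[ℂ] HS ι)
  apply toL2_injective
  rw [toL2_smul, toL2_semigroup, toL2_semigroup, toL2_add, toL2_smul, toL2_id]
  have h1 : t • -(toL2 A + c • (1 : HS ι →L[ℂ] HS ι)) =
      t • (-toL2 A) + algebraMap ℂ (HS ι →L[ℂ] HS ι) (-t * c) := by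
    rw [Algebra.algebraMap_eq_smul_one, neg_add, smul_add]
    congr 1
    ext v
    simp [mul_smul]
  rw [h1, NormedSpace.exp_add_of_commute (Algebra.commutes _ _).symm,
    ← NormedSpace.algebraMap_exp_comm, ← Complex.exp_eq_exp_ℂ, Algebra.algebraMap_eq_smul_one,
    mul_smul_comm, mul_one]

variable [DecidableEq ι]

theorem isGenerator_smul_id_sub {κ : ℝ} {Ψ : SuperOp ι} (hΨ : IsCompletelyPositive Ψ)
    (h1 : Ψ 1 = (κ : ℂ) • 1) (hs : IsSelfAdjoint (toL2 Ψ)) :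
    IsGenerator ((κ : ℂ) • LinearMap.id - Ψ) := by
  intro t ht
  have he : semigroup ((κ : ℂ) • LinearMap.id - Ψ) t =
      ((Real.exp (-t * κ) : ℝ) : ℂ) • ofL2 (NormedSpace.exp (toL2 ((t : ℂ) • Ψ))) := by
    have : (κ : ℂ) • LinearMap.id - Ψ = -Ψ + (κ : ℂ) • LinearMap.id := by abel
    rw [this, semigroup_add_smul_id]
    congr 1
    · push_cast; rfl
    · apply toL2_injective
      rw [toL2_semigroup, toL2_ofL2, show toL2 (-Ψ) = -toL2 Ψ from rfl, neg_neg, toL2_smul]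
      congr 1
  have hcp : IsCompletelyPositive (ofL2 (toL2 ((t : ℂ) • Ψ))) := by
    rw [ofL2_toL2]
    exact hΨ.smul ht
  refine ⟨?_, semigroup_apply_of_eq_zero (by simp [h1]) t, ?_⟩
  · rw [he]
    exact (isCompletelyPositive_exp hcp).smul (Real.exp_nonneg _)
  · rw [he, toL2_smul, toL2_ofL2]
    have hr : ∀ r : ℝ, IsSelfAdjoint (r : ℂ) := fun r => Complex.conj_ofReal r
    have hQ : IsSelfAdjoint (toL2 ((t : ℂ) • Ψ)) := by
      rw [toL2_smul]
      exact (hr t).smul hs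
    exact (hr _).smul (IsSelfAdjoint.exp hQ)

end Cone

section Markov
open Filter Topology

variable {ι : Type} [Fintype ι]

/-! ### The orthogonal projection onto the fixed points -/

theorem toL2_fixedExp (A : SuperOp ι) :
    toL2 (fixedExp A) = ((fixedPoints A).map vec.toLinearMap).starProjection := toL2_ofL2 _

theorem fixedPoints_amplify (A : SuperOp ι) (k : ℕ) (X : Matrix (Fin k × ι) (Fin k × ι) ℂ) :
    X ∈ fixedPoints (amplify k A) ↔ ∀ i j, block X i j ∈ fixedPoints A := by
  simp only [mem_fixedPoints_iff, ← block_amplify]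
  refine ⟨fun h i j => by rw [h]; rfl, fun h => ext_block h⟩

theorem fixedExp_mem (A : SuperOp ι) (x : Matrix ι ι ℂ) : fixedExp A x ∈ fixedPoints A := by
  have h := Submodule.starProjection_apply_mem ((fixedPoints A).map vec.toLinearMap) (vec x)
  rw [← toL2_fixedExp, toL2_vec] at h
  obtain ⟨y, hy, hxy⟩ := h
  rwa [← vec.injective hxy]

theorem isSelfAdjoint_fixedExp (A : SuperOp ι) : IsSelfAdjoint (toL2 (fixedExp A)) := by
  rw [toL2_fixedExp]
  exact isSelfAdjoint_starProjection _

theorem fixedExp_eq_of_mem {A : SuperOp ι} {x y : Matrix ι ι ℂ} (hy : y ∈ fixedPoints A)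
    (h : ∀ w ∈ fixedPoints A, ((x - y)ᴴ * w).trace = 0) : fixedExp A x = y := by
  apply vec.injective
  rw [← toL2_vec, toL2_fixedExp]
  apply Submodule.eq_starProjection_of_mem_of_inner_eq_zero
  · exact ⟨y, hy, rfl⟩
  · rintro _ ⟨w, hw, rfl⟩
    rw [← map_sub]
    exact (inner_vec _ _).trans (h w hw)

theorem fixedExp_of_mem {A : SuperOp ι} {x : Matrix ι ι ℂ} (hx : x ∈ fixedPoints A) :
    fixedExp A x = x :=
  fixedExp_eq_of_mem hx (by simp)

/-- `E_N` is characterised by `tr(E_N(x)^* w) = tr(x^* w)` for `w ∈ N`. -/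
theorem trace_fixedExp_conjTranspose_mul {A : SuperOp ι} (x : Matrix ι ι ℂ) {w : Matrix ι ι ℂ}
    (hw : w ∈ fixedPoints A) : ((fixedExp A x)ᴴ * w).trace = (xᴴ * w).trace := by
  rw [(isSelfAdjoint_toL2_iff _).1 (isSelfAdjoint_fixedExp A), fixedExp_of_mem hw]

theorem fixedExp_congr {A B : SuperOp ι} (h : fixedPoints A = fixedPoints B) :
    fixedExp A = fixedExp B := by
  simp only [fixedExp, h]

theorem fixedExp_amplify (A : SuperOp ι) (k : ℕ) :
    fixedExp (amplify k A) = amplify k (fixedExp A) := by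
  ext1 X
  refine fixedExp_eq_of_mem ?_ fun W hW => ?_
  · rw [fixedPoints_amplify]
    intro i j
    rw [block_amplify]
    exact fixedExp_mem A _
  · rw [fixedPoints_amplify] at hW
    rw [Matrix.conjTranspose_sub, sub_mul, Matrix.trace_sub, sub_eq_zero]
    simp only [trace_eq_sum_block, block_mul, block_conjTranspose, block_amplify,
      Matrix.trace_sum, trace_fixedExp_conjTranspose_mul _ (hW _ _)]

/-! ### Symmetric Markov maps -/

/-- A unital completely positive map which is self-adjoint on `L_2(M_m, tr)`. -/
structure IsMarkov [DecidableEq ι] (Φ : SuperOp ι) : Prop where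
  completelyPositive : IsCompletelyPositive Φ
  map_one : Φ 1 = 1
  isSelfAdjoint : IsSelfAdjoint (toL2 Φ)

variable [DecidableEq ι]

theorem IsGenerator.isMarkov {A : SuperOp ι} (hA : IsGenerator A) {t : ℝ} (ht : 0 ≤ t) :
    IsMarkov (semigroup A t) :=
  ⟨(hA t ht).1, (hA t ht).2.1, (hA t ht).2.2⟩

theorem trace_of_isSelfAdjoint {Φ : SuperOp ι} {κ : ℂ} (hs : IsSelfAdjoint (toL2 Φ))
    (h1 : Φ 1 = κ • 1) (y : Matrix ι ι ℂ) : (Φ y).trace = star κ * y.trace := by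
  have h := (isSelfAdjoint_toL2_iff Φ).1 hs 1 y
  rw [h1] at h
  simpa using h.symm

/-- The Dirichlet form of `κ I - Φ` is a sum of squares of commutators with Kraus operators. -/
theorem sum_norm_commutator {Φ : SuperOp ι} {c : ℝ} (hΦ : IsCompletelyPositive Φ)
    (hs : IsSelfAdjoint (toL2 Φ)) (h1 : Φ 1 = (c : ℂ) • 1) {κ : Type*} [Fintype κ]
    {K : κ → Matrix ι ι ℂ} (hK : ∀ x, Φ x = ∑ r, (K r)ᴴ * x * K r) (x : Matrix ι ι ℂ) :
    ∑ r, ‖vec (x * K r - K r * x)‖ ^ 2 = 2 * (c * ‖vec x‖ ^ 2 - (xᴴ * Φ x).trace.re) := by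
  have hg := congrArg (fun y => y.trace.re) (kraus_gradient hK x x)
  simp only [h1, Matrix.mul_smul, Matrix.smul_mul, Matrix.mul_one, Matrix.trace_add,
    Matrix.trace_sub, Matrix.trace_sum, Matrix.trace_smul, smul_eq_mul, Complex.re_ofReal_mul,
    Complex.re_sum, Complex.add_re, Complex.sub_re, ← norm_vec_sq, trace_of_isSelfAdjoint hs h1,
    Complex.star_def, Complex.conj_ofReal, hΦ.map_conjTranspose,
    (isSelfAdjoint_toL2_iff Φ).1 hs] at hg
  linarith

theorem re_trace_conjTranspose_mul_map_le {Φ : SuperOp ι} {c : ℝ} (hΦ : IsCompletelyPositive Φ)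
    (hs : IsSelfAdjoint (toL2 Φ)) (h1 : Φ 1 = (c : ℂ) • 1) (x : Matrix ι ι ℂ) :
    (xᴴ * Φ x).trace.re ≤ c * ‖vec x‖ ^ 2 := by
  obtain ⟨K, hK⟩ := hΦ.exists_kraus
  have h1 := sum_norm_commutator hΦ hs h1 hK x
  have h2 : 0 ≤ ∑ r, ‖vec (x * K r - K r * x)‖ ^ 2 := Finset.sum_nonneg fun _ _ => sq_nonneg _
  linarith

namespace IsMarkov

variable {Φ : SuperOp ι} (h : IsMarkov Φ)
include h

theorem re_trace_le (x : Matrix ι ι ℂ) : (xᴴ * Φ x).trace.re ≤ ‖vec x‖ ^ 2 := by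
  simpa using re_trace_conjTranspose_mul_map_le (c := 1) h.completelyPositive h.isSelfAdjoint
    (by simp [h.map_one]) x

theorem commute_kraus {κ : Type*} [Fintype κ] {K : κ → Matrix ι ι ℂ}
    (hK : ∀ x, Φ x = ∑ r, (K r)ᴴ * x * K r) {x : Matrix ι ι ℂ} (hx : Φ x = x) (r : κ) :
    x * K r = K r * x := by
  have h1 := sum_norm_commutator (c := 1) h.completelyPositive h.isSelfAdjoint
    (by simp [h.map_one]) hK x
  rw [hx, ← norm_vec_sq, one_mul, sub_self, mul_zero] at h1
  have h2 := (Finset.sum_eq_zero_iff_of_nonneg fun _ _ => sq_nonneg _).1 h1 r (Finset.mem_univ r)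
  rw [sq_eq_zero_iff, norm_eq_zero] at h2
  exact sub_eq_zero.1 (vec.map_eq_zero_iff.1 h2)

theorem map_conjTranspose_of_fixed {x : Matrix ι ι ℂ} (hx : Φ x = x) : Φ xᴴ = xᴴ := by
  rw [h.completelyPositive.map_conjTranspose, hx]

/-- Fixed points of a symmetric Markov map lie in its multiplicative domain. -/
theorem map_mul_left {x : Matrix ι ι ℂ} (hx : Φ x = x) (y : Matrix ι ι ℂ) :
    Φ (x * y) = x * Φ y := by
  obtain ⟨K, hK⟩ := h.completelyPositive.exists_kraus
  rw [hK, hK, Finset.mul_sum]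
  refine Finset.sum_congr rfl fun r _ => ?_
  have h1 : (K r)ᴴ * x = x * (K r)ᴴ := by
    have := congrArg Matrix.conjTranspose
      (h.commute_kraus hK (h.map_conjTranspose_of_fixed hx) r)
    simpa using this
  simp only [← Matrix.mul_assoc, h1]

theorem map_mul_right {x : Matrix ι ι ℂ} (hx : Φ x = x) (y : Matrix ι ι ℂ) :
    Φ (y * x) = Φ y * x := by
  obtain ⟨K, hK⟩ := h.completelyPositive.exists_kraus
  rw [hK, hK, Finset.sum_mul]
  refine Finset.sum_congr rfl fun r _ => ?_
  simp only [Matrix.mul_assoc, h.commute_kraus hK hx r]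

end IsMarkov

theorem norm_toL2_semigroup_le {A : SuperOp ι} (hA : IsGenerator A) {t : ℝ} (ht : 0 ≤ t) :
    ‖toL2 (semigroup A t)‖ ≤ 1 := by
  refine ContinuousLinearMap.opNorm_le_bound _ zero_le_one fun v => ?_
  obtain ⟨x, rfl⟩ := vec.surjective v
  rw [toL2_vec, one_mul, ← sq_le_sq₀ (norm_nonneg _) (norm_nonneg _), norm_vec_sq,
    (isSelfAdjoint_toL2_iff _).1 (hA.isMarkov ht).isSelfAdjoint]
  have h := (hA.isMarkov (add_nonneg ht ht)).re_trace_le x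
  rwa [semigroup_add] at h

theorem isSelfAdjoint_of_isGenerator {A : SuperOp ι} (hA : IsGenerator A) :
    IsSelfAdjoint (toL2 A) := by
  have h := (hasDerivAt_semigroup_zero A).tendsto_slope_zero_right
  have hc : IsClosed {S : HS ι →L[ℂ] HS ι | IsSelfAdjoint S} :=
    isClosed_eq continuous_star continuous_id
  have hm : -toL2 A ∈ {S : HS ι →L[ℂ] HS ι | IsSelfAdjoint S} := by
    refine hc.mem_of_tendsto h ?_
    filter_upwards [self_mem_nhdsWithin] with t ht
    have h1 : IsSelfAdjoint (toL2 (semigroup A t)) := (hA.isMarkov (le_of_lt ht)).isSelfAdjoint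
    have h0 : IsSelfAdjoint (toL2 (semigroup A 0)) := (hA.isMarkov le_rfl).isSelfAdjoint
    rw [zero_add]
    exact (IsSelfAdjoint.all (t⁻¹)).smul (h1.sub h0)
  have h' : IsSelfAdjoint (-toL2 A) := hm
  simpa using h'.neg

/-! ### The fixed points form an algebra -/

theorem one_mem_fixedPoints {A : SuperOp ι} (hA : IsGenerator A) : 1 ∈ fixedPoints A :=
  fun _ ht => (hA.isMarkov ht).map_one

theorem conjTranspose_mem_fixedPoints {A : SuperOp ι} (hA : IsGenerator A) {x : Matrix ι ι ℂ}
    (hx : x ∈ fixedPoints A) : xᴴ ∈ fixedPoints A :=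
  fun t ht => (hA.isMarkov ht).map_conjTranspose_of_fixed (hx t ht)

theorem mul_mem_fixedPoints {A : SuperOp ι} (hA : IsGenerator A) {x y : Matrix ι ι ℂ}
    (hx : x ∈ fixedPoints A) (hy : y ∈ fixedPoints A) : x * y ∈ fixedPoints A :=
  fun t ht => by rw [(hA.isMarkov ht).map_mul_left (hx t ht), hy t ht]

/-! ### Convergence to equilibrium -/

/-- `T_t → E_N` as `t → ∞`. In an orthonormal basis of eigenvectors of `A` the semigroup is the
diagonal matrix of the `e^{-tλ}`; the eigenvalues are nonnegative since `T_t` is a contraction. -/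
theorem tendsto_semigroup {A : SuperOp ι} (hA : IsGenerator A) :
    Tendsto (fun t => toL2 (semigroup A t)) atTop (𝓝 (toL2 (fixedExp A))) := by
  have hs := ContinuousLinearMap.isSelfAdjoint_iff_isSymmetric.1 (isSelfAdjoint_of_isGenerator hA)
  let b := hs.eigenvectorBasis rfl
  let l := hs.eigenvalues rfl
  have hb : ∀ i, A (vec.symm (b i)) = (l i : ℂ) • vec.symm (b i) := by
    intro i
    have := hs.apply_eigenvectorBasis rfl i
    apply vec.injective
    rw [map_smul, vec.apply_symm_apply]
    exact this
  have hT : ∀ i t, toL2 (semigroup A t) (b i) = (Real.exp (-t * l i) : ℂ) • b i := by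
    intro i t
    have h0 := semigroup_apply_of_eq_zero (A := A + (-(l i : ℂ)) • LinearMap.id)
      (x := vec.symm (b i)) (by simp [hb]) t
    rw [semigroup_add_smul_id, LinearMap.smul_apply] at h0
    have h1 : semigroup A t (vec.symm (b i)) = Complex.exp (-t * l i) • vec.symm (b i) := by
      conv_rhs => rw [← h0]
      rw [smul_smul, ← Complex.exp_add]
      simp
    have h2 := congrArg vec h1
    rw [map_smul, vec.apply_symm_apply] at h2
    push_cast
    exact h2
  have hpos : ∀ i, 0 ≤ l i := by
    intro i
    have h1 := (toL2 (semigroup A 1)).le_of_opNorm_le (norm_toL2_semigroup_le hA zero_le_one) (b i)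
    rw [hT, norm_smul, b.norm_eq_one, Complex.norm_real,
      Real.norm_of_nonneg (Real.exp_nonneg _)] at h1
    simpa using h1
  have hE : ∀ i, toL2 (fixedExp A) (b i) = (if l i = 0 then (1 : ℂ) else 0) • b i := by
    intro i
    have hx : b i = vec (vec.symm (b i)) := (vec.apply_symm_apply _).symm
    rw [hx, toL2_vec, ← map_smul]
    congr 1
    split_ifs with h
    · rw [one_smul]
      exact fixedExp_of_mem (mem_fixedPoints_iff.2 (by simp [hb, h]))
    · rw [zero_smul]
      refine fixedExp_eq_of_mem (Submodule.zero_mem _) fun w hw => ?_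
      have h1 := (isSelfAdjoint_toL2_iff A).1 (isSelfAdjoint_of_isGenerator hA) (vec.symm (b i)) w
      rw [mem_fixedPoints_iff.1 hw, hb] at h1
      simpa [h] using h1
  have hsum : ∀ S : HS ι →L[ℂ] HS ι, S = ∑ i, InnerProductSpace.rankOne ℂ (S (b i)) (b i) := by
    intro S
    ext v
    conv_lhs => rw [← b.sum_repr' v]
    simp
  rw [hsum (toL2 (fixedExp A))]
  have hf : (fun t => toL2 (semigroup A t)) = fun t =>
      ∑ i, InnerProductSpace.rankOne ℂ (toL2 (semigroup A t) (b i)) (b i) := by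
    ext1 t
    exact hsum _
  rw [hf]
  refine tendsto_finsetSum _ fun i _ => ?_
  have hi : Tendsto (fun t : ℝ => ((Real.exp (-t * l i) : ℝ) : ℂ)) atTop
      (𝓝 (if l i = 0 then (1 : ℂ) else 0)) := by
    split_ifs with h
    · simp [h]
    · have hl : 0 < l i := lt_of_le_of_ne (hpos i) (Ne.symm h)
      rw [← Complex.ofReal_zero]
      refine (Complex.continuous_ofReal.tendsto 0).comp ?_
      refine Real.tendsto_exp_atBot.comp ?_
      simp only [neg_mul]
      exact tendsto_neg_atTop_atBot.comp (tendsto_id.atTop_mul_const hl)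
  simp only [hT, hE, map_smul, smul_apply]
  exact hi.smul_const _

theorem isMarkov_fixedExp {A : SuperOp ι} (hA : IsGenerator A) : IsMarkov (fixedExp A) where
  completelyPositive := by
    rw [← ofL2_toL2 (fixedExp A)]
    refine isClosed_completelyPositive.mem_of_tendsto (tendsto_semigroup hA) ?_
    filter_upwards [eventually_ge_atTop 0] with t ht
    exact (hA.isMarkov ht).completelyPositive
  map_one := fixedExp_of_mem (one_mem_fixedPoints hA)
  isSelfAdjoint := isSelfAdjoint_fixedExp A

end Markov

section MatrixAnalysis
open Filter Topology

variable {n : Type} [Fintype n]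

/-! ### Trace inequalities for the functional calculus -/

theorem re_trace_mul_nonneg {A B : Matrix n n ℂ} (hA : A.PosSemidef) (hB : B.PosSemidef) :
    0 ≤ (A * B).trace.re := by
  classical
  obtain ⟨s, rfl⟩ := (posSemidef_iff_conjTranspose_mul _).1 hA
  rw [Matrix.mul_assoc, Matrix.trace_mul_comm]
  exact (Complex.nonneg_iff.1 (hB.mul_mul_conjTranspose_same s).trace_nonneg).1

variable [DecidableEq n]

theorem continuousOn_spectrum (f : ℝ → ℝ) (ρ : Matrix n n ℂ) : ContinuousOn f (spectrum ℝ ρ) :=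
  Matrix.finite_real_spectrum.continuousOn f

theorem exists_spectral_resolution {ρ : Matrix n n ℂ} (hρ : ρ.IsHermitian) :
    ∃ P : n → Matrix n n ℂ, (∀ i, (P i).PosSemidef) ∧ ∑ i, P i = 1 ∧
      ∀ f : ℝ → ℝ, cfc f ρ = ∑ i, ((f (hρ.eigenvalues i) : ℝ) : ℂ) • P i := by
  let U : Matrix n n ℂ := hρ.eigenvectorUnitary
  have key : ∀ f : ℝ → ℝ, cfc f ρ = ∑ i, ((f (hρ.eigenvalues i) : ℝ) : ℂ) •
      Matrix.vecMulVec (fun p => U p i) (star fun p => U p i) := by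
    intro f
    rw [hρ.cfc_eq, Matrix.IsHermitian.cfc, Unitary.conjStarAlgAut_apply]
    ext p q
    rw [Matrix.mul_apply, Matrix.sum_apply]
    refine Finset.sum_congr rfl fun i _ => ?_
    rw [Matrix.mul_diagonal, Matrix.smul_apply, Matrix.vecMulVec_apply, Matrix.star_apply]
    simp only [Function.comp_apply, Pi.star_apply, smul_eq_mul, U, Complex.coe_algebraMap]
    ring
  refine ⟨fun i => Matrix.vecMulVec (fun p => U p i) (star fun p => U p i),
    fun i => Matrix.posSemidef_vecMulVec_self_star _, ?_, key⟩
  have h1 := key fun _ => 1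
  rw [cfc_const_one ℝ ρ] at h1
  simpa using h1.symm

theorem cfc_add_smul_one {ρ : Matrix n n ℂ} (hρ : ρ.IsHermitian) (g : ℝ → ℝ) (δ : ℝ) :
    cfc g (ρ + (δ : ℂ) • 1) = cfc (fun x => g (x + δ)) ρ := by
  have h : cfc (fun x : ℝ => x + δ) ρ = ρ + (δ : ℂ) • 1 := by
    rw [cfc_add_const δ _ ρ, cfc_id' ℝ ρ]
    simp [Algebra.algebraMap_eq_smul_one]
  rw [← h, ← cfc_comp' g (fun x => x + δ) ρ
    ((Matrix.finite_real_spectrum.image _).continuousOn _)]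

theorem cfc_mul_cfc (f g : ℝ → ℝ) (ρ : Matrix n n ℂ) :
    cfc f ρ * cfc g ρ = cfc (fun x => f x * g x) ρ :=
  (cfc_mul f g ρ (continuousOn_spectrum f ρ) (continuousOn_spectrum g ρ)).symm

theorem mul_cfc {ρ : Matrix n n ℂ} (hρ : ρ.IsHermitian) (g : ℝ → ℝ) :
    ρ * cfc g ρ = cfc (fun x => x * g x) ρ := by
  rw [← cfc_mul_cfc (fun x => x) g, cfc_id' ℝ ρ]

theorem isHermitian_cfc (f : ℝ → ℝ) (ρ : Matrix n n ℂ) : (cfc f ρ).IsHermitian :=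
  cfc_predicate f ρ

/-- On matrices the functional calculus is polynomial, so that it preserves every unital algebra
of matrices. -/
theorem cfc_mem_of_mul_mem {N : Submodule ℂ (Matrix n n ℂ)} (h1 : 1 ∈ N)
    (hm : ∀ x ∈ N, ∀ y ∈ N, x * y ∈ N) {ρ : Matrix n n ℂ} (hρ : ρ.IsHermitian) (hN : ρ ∈ N)
    (f : ℝ → ℝ) : cfc f ρ ∈ N := by
  let q := Lagrange.interpolate (Matrix.finite_real_spectrum (A := ρ)).toFinset id f
  have hq : cfc f ρ = cfc (fun x => q.eval x) ρ := by
    apply cfc_congr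
    intro x hx
    have := Lagrange.eval_interpolate_at_node (v := id) f Function.injective_id.injOn
      ((Matrix.finite_real_spectrum (A := ρ)).mem_toFinset.2 hx)
    exact this.symm
  have hpow : ∀ i : ℕ, ρ ^ i ∈ N := by
    intro i
    induction i with
    | zero => simpa using h1
    | succ i ih => rw [pow_succ]; exact hm _ ih _ hN
  rw [hq, cfc_polynomial q ρ, Polynomial.aeval_eq_sum_range]
  refine N.sum_mem fun i _ => ?_
  have : q.coeff i • ρ ^ i = ((q.coeff i : ℝ) : ℂ) • ρ ^ i := (Complex.coe_smul _ _).symm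
  rw [this]
  exact N.smul_mem _ (hpow i)

/-- Entropy production is nonnegative: with spectral projections `P_i` of `ρ`, the trace equals
`½ ∑ tr(Ψ(P_i) P_j) (r_i - r_j) (g(r_i) - g(r_j))`. -/
theorem entropyProduction_nonneg {Ψ : SuperOp n} {κ : ℝ}
    (hpos : ∀ x : Matrix n n ℂ, x.PosSemidef → (Ψ x).PosSemidef) (h1 : Ψ 1 = (κ : ℂ) • 1)
    (hs : IsSelfAdjoint (toL2 Ψ)) {ρ : Matrix n n ℂ} (hρ : ρ.PosSemidef) {g : ℝ → ℝ}
    (hg : MonotoneOn g (Set.Ici 0)) :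
    0 ≤ (((κ : ℂ) • ρ - Ψ ρ) * cfc g ρ).trace.re := by
  obtain ⟨P, hP, hP1, hcfc⟩ := exists_spectral_resolution hρ.isHermitian
  set r := hρ.isHermitian.eigenvalues with hr
  let w : n → n → ℝ := fun i j => (Ψ (P i) * P j).trace.re
  have hw : ∀ i j, 0 ≤ w i j := fun i j => re_trace_mul_nonneg (hpos _ (hP i)) (hP j)
  have hsymm : ∀ i j, w i j = w j i := by
    intro i j
    have h := (isSelfAdjoint_toL2_iff Ψ).1 hs (P i) (P j)
    rw [(hpos _ (hP i)).isHermitian.eq, (hP i).isHermitian.eq] at h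
    simp only [w]
    rw [h, Matrix.trace_mul_comm]
  have hrow : ∀ i, ∑ j, w i j = κ * (P i).trace.re := by
    intro i
    simp only [w]
    rw [← Complex.re_sum, ← Matrix.trace_sum, ← Finset.mul_sum, hP1, Matrix.mul_one,
      trace_of_isSelfAdjoint hs h1]
    simp
  have hsa : IsSelfAdjoint ρ := hρ.isHermitian
  have hρs : ρ = ∑ i, (r i : ℂ) • P i := by
    conv_lhs => rw [← cfc_id' ℝ ρ]
    exact hcfc _
  have e1 : (ρ * cfc g ρ).trace.re = ∑ i, r i * g (r i) * (P i).trace.re := by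
    rw [mul_cfc hρ.isHermitian, hcfc, Matrix.trace_sum, Complex.re_sum]
    refine Finset.sum_congr rfl fun i _ => ?_
    rw [Matrix.trace_smul, smul_eq_mul, Complex.re_ofReal_mul]
  have e2 : (Ψ ρ * cfc g ρ).trace.re = ∑ i, ∑ j, r i * g (r j) * w i j := by
    rw [hcfc g]
    conv_lhs => rw [hρs]
    simp only [map_sum, map_smul, Finset.sum_mul, Finset.mul_sum, Matrix.trace_sum, Complex.re_sum,
      Matrix.smul_mul, Matrix.mul_smul, Matrix.trace_smul, smul_eq_mul, Complex.re_ofReal_mul]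
    rw [Finset.sum_comm]
    refine Finset.sum_congr rfl fun i _ => Finset.sum_congr rfl fun j _ => ?_
    simp only [w]
    ring
  have e3 : (((κ : ℂ) • ρ - Ψ ρ) * cfc g ρ).trace.re =
      ∑ i, ∑ j, w i j * (r i * g (r i) - r i * g (r j)) := by
    rw [sub_mul, Matrix.trace_sub, Complex.sub_re, e2, Matrix.smul_mul, Matrix.trace_smul,
      smul_eq_mul, Complex.re_ofReal_mul, e1, Finset.mul_sum, ← Finset.sum_sub_distrib]
    refine Finset.sum_congr rfl fun i _ => ?_
    have : κ * (r i * g (r i) * (P i).trace.re) = r i * g (r i) * ∑ j, w i j := by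
      rw [hrow]; ring
    rw [this, Finset.mul_sum, ← Finset.sum_sub_distrib]
    refine Finset.sum_congr rfl fun j _ => ?_
    ring
  have e4 : ∑ i, ∑ j, w i j * (r i * g (r i) - r i * g (r j)) =
      ∑ i, ∑ j, w i j * (r j * g (r j) - r j * g (r i)) := by
    rw [Finset.sum_comm]
    exact Finset.sum_congr rfl fun i _ => Finset.sum_congr rfl fun j _ => by rw [hsymm]
  have e5 : 0 ≤ ∑ i, ∑ j, w i j * ((r i - r j) * (g (r i) - g (r j))) := by
    refine Finset.sum_nonneg fun i _ => Finset.sum_nonneg fun j _ => mul_nonneg (hw i j) ?_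
    rcases le_total (r i) (r j) with h | h
    · exact mul_nonneg_of_nonpos_of_nonpos (sub_nonpos.2 h)
        (sub_nonpos.2 (hg (hρ.eigenvalues_nonneg i) (hρ.eigenvalues_nonneg j) h))
    · exact mul_nonneg (sub_nonneg.2 h)
        (sub_nonneg.2 (hg (hρ.eigenvalues_nonneg j) (hρ.eigenvalues_nonneg i) h))
  have e6 : ∑ i, ∑ j, w i j * ((r i - r j) * (g (r i) - g (r j))) =
      ∑ i, ∑ j, w i j * (r i * g (r i) - r i * g (r j)) +
      ∑ i, ∑ j, w i j * (r j * g (r j) - r j * g (r i)) := by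
    rw [← Finset.sum_add_distrib]
    refine Finset.sum_congr rfl fun i _ => ?_
    rw [← Finset.sum_add_distrib]
    exact Finset.sum_congr rfl fun j _ => by ring
  rw [e3]
  linarith

/-- Klein's inequality: the relative entropy of positive definite matrices of equal trace is
nonnegative. -/
theorem re_trace_mul_log_le {σ ρ : Matrix n n ℂ} (hσ : σ.PosDef) (hρ : ρ.PosDef)
    (htr : σ.trace = ρ.trace) :
    (σ * cfc Real.log ρ).trace.re ≤ (σ * cfc Real.log σ).trace.re := by
  have hσa : IsSelfAdjoint σ := hσ.isHermitian
  have hρa : IsSelfAdjoint ρ := hρ.isHermitian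
  obtain ⟨P, hP, hP1, hPf⟩ := exists_spectral_resolution hσ.isHermitian
  obtain ⟨Q, hQ, hQ1, hQf⟩ := exists_spectral_resolution hρ.isHermitian
  set s := hσ.isHermitian.eigenvalues
  set r := hρ.isHermitian.eigenvalues
  let w : n → n → ℝ := fun i j => (P i * Q j).trace.re
  have hsum : ∀ f g : ℝ → ℝ, (cfc f σ * cfc g ρ).trace.re =
      ∑ i, ∑ j, f (s i) * g (r j) * w i j := by
    intro f g
    rw [hPf, hQf]
    simp only [Finset.sum_mul, Finset.mul_sum, Matrix.trace_sum, Complex.re_sum,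
      Matrix.smul_mul, Matrix.mul_smul, Matrix.trace_smul, smul_eq_mul, Complex.re_ofReal_mul]
    rw [Finset.sum_comm]
    refine Finset.sum_congr rfl fun i _ => Finset.sum_congr rfl fun j _ => ?_
    simp only [w]
    ring
  have h1 : (σ * cfc Real.log ρ).trace.re = ∑ i, ∑ j, s i * Real.log (r j) * w i j := by
    rw [← hsum (fun x => x) Real.log, cfc_id' ℝ σ]
  have h2 : (σ * cfc Real.log σ).trace.re = ∑ i, ∑ j, s i * Real.log (s i) * 1 * w i j := by
    rw [mul_cfc hσ.isHermitian, ← hsum (fun x => x * Real.log x) fun _ => 1, cfc_const_one ℝ ρ,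
      Matrix.mul_one]
  have h3 : σ.trace.re = ∑ i, ∑ j, s i * 1 * w i j := by
    rw [← hsum (fun x => x) fun _ => 1, cfc_const_one ℝ ρ, cfc_id' ℝ σ, Matrix.mul_one]
  have h4 : ρ.trace.re = ∑ i, ∑ j, 1 * r j * w i j := by
    rw [← hsum (fun _ => 1) fun x => x, cfc_const_one ℝ σ, cfc_id' ℝ ρ, Matrix.one_mul]
  have h5 : ∑ i, ∑ j, s i * Real.log (r j) * w i j + ∑ i, ∑ j, s i * 1 * w i j ≤
      ∑ i, ∑ j, s i * Real.log (s i) * 1 * w i j + ∑ i, ∑ j, 1 * r j * w i j := by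
    rw [← Finset.sum_add_distrib, ← Finset.sum_add_distrib]
    refine Finset.sum_le_sum fun i _ => ?_
    rw [← Finset.sum_add_distrib, ← Finset.sum_add_distrib]
    refine Finset.sum_le_sum fun j _ => ?_
    have hw : 0 ≤ w i j := re_trace_mul_nonneg (hP i) (hQ j)
    have hs : 0 < s i := hσ.eigenvalues_pos i
    have hr : 0 < r j := hρ.eigenvalues_pos j
    have hl := Real.log_le_sub_one_of_pos (div_pos hr hs)
    rw [Real.log_div hr.ne' hs.ne'] at hl
    have hl2 : s i * (Real.log (r j) - Real.log (s i)) ≤ r j - s i := by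
      calc _ ≤ s i * (r j / s i - 1) := mul_le_mul_of_nonneg_left hl hs.le
        _ = _ := by field_simp
    have := mul_le_mul_of_nonneg_right hl2 hw
    linarith
  rw [htr] at h3
  linarith

theorem tendsto_trace_mul_log {ρ : Matrix n n ℂ} (hρ : ρ.PosSemidef) :
    Tendsto (fun δ : ℝ => ((ρ + (δ : ℂ) • 1) * cfc Real.log (ρ + (δ : ℂ) • 1)).trace.re)
      (𝓝[>] 0) (𝓝 (ρ * cfc Real.log ρ).trace.re) := by
  obtain ⟨P, hP, hP1, hPf⟩ := exists_spectral_resolution hρ.isHermitian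
  have hsum : ∀ f : ℝ → ℝ, (cfc f ρ).trace.re =
      ∑ i, f (hρ.isHermitian.eigenvalues i) * (P i).trace.re := by
    intro f
    simp only [hPf, Matrix.trace_sum, Matrix.trace_smul, smul_eq_mul, Complex.re_sum,
      Complex.re_ofReal_mul]
  have hh : ∀ δ : ℝ, (ρ + (δ : ℂ) • 1).IsHermitian := by
    intro δ
    refine hρ.isHermitian.add ?_
    rw [Matrix.IsHermitian, Matrix.conjTranspose_smul, Matrix.conjTranspose_one, Complex.star_def,
      Complex.conj_ofReal]
  have hδ : ∀ δ : ℝ, ((ρ + (δ : ℂ) • 1) * cfc Real.log (ρ + (δ : ℂ) • 1)).trace.re =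
      ∑ i, ((hρ.isHermitian.eigenvalues i + δ) * Real.log (hρ.isHermitian.eigenvalues i + δ)) *
        (P i).trace.re := by
    intro δ
    rw [mul_cfc (hh δ), cfc_add_smul_one hρ.isHermitian, hsum]
  simp only [hδ, mul_cfc hρ.isHermitian, hsum]
  refine tendsto_nhdsWithin_of_tendsto_nhds ?_
  refine tendsto_finsetSum _ fun i _ => Tendsto.mul_const (P i).trace.re ?_
  have hc : Continuous fun δ : ℝ => (hρ.isHermitian.eigenvalues i + δ) *
      Real.log (hρ.isHermitian.eigenvalues i + δ) :=
    Real.continuous_mul_log.comp (continuous_const.add continuous_id)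
  simpa using hc.tendsto 0

/-! ### The trace norm -/

theorem sum_eigenvalues_eq_norm_sq (X : Matrix n n ℂ) :
    ∑ i, (Matrix.isHermitian_conjTranspose_mul_self X).eigenvalues i = ‖vec X‖ ^ 2 := by
  rw [norm_vec_sq, (Matrix.isHermitian_conjTranspose_mul_self X).trace_eq_sum_eigenvalues]
  simp

theorem eigenvalues_conjTranspose_mul_self_nonneg (X : Matrix n n ℂ) (i : n) :
    0 ≤ (Matrix.isHermitian_conjTranspose_mul_self X).eigenvalues i :=
  (Matrix.posSemidef_conjTranspose_mul_self X).eigenvalues_nonneg i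

theorem norm_vec_le_traceNorm (X : Matrix n n ℂ) : ‖vec X‖ ≤ traceNorm X := by
  have h0 : 0 ≤ traceNorm X := Finset.sum_nonneg fun _ _ => Real.sqrt_nonneg _
  rw [← sq_le_sq₀ (norm_nonneg _) h0, ← sum_eigenvalues_eq_norm_sq]
  calc _ = ∑ i, √((Matrix.isHermitian_conjTranspose_mul_self X).eigenvalues i) ^ 2 :=
        Finset.sum_congr rfl fun i _ =>
          (Real.sq_sqrt (eigenvalues_conjTranspose_mul_self_nonneg X i)).symm
    _ ≤ _ := Finset.sum_sq_le_sq_sum_of_nonneg fun i _ => Real.sqrt_nonneg _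

/-- Hölder's inequality `‖PQ‖_1 ≤ ‖P‖_2 ‖Q‖_2`. With a unitary `U` diagonalizing `(PQ)^* PQ` and the
partial isometry `W = PQ U D^{-1/2}`, the trace norm is `tr(W^* P Q U)`. -/
theorem traceNorm_mul_le (P Q : Matrix n n ℂ) : traceNorm (P * Q) ≤ ‖vec P‖ * ‖vec Q‖ := by
  set Z := P * Q with hZ
  let hH := Matrix.isHermitian_conjTranspose_mul_self Z
  let U : Matrix n n ℂ := hH.eigenvectorUnitary
  have hUU : Uᴴ * U = 1 := Unitary.coe_star_mul_self hH.eigenvectorUnitary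
  have hUU' : U * Uᴴ = 1 := Unitary.coe_mul_star_self hH.eigenvectorUnitary
  let μ : n → ℝ := hH.eigenvalues
  have hμ : ∀ i, 0 ≤ μ i := eigenvalues_conjTranspose_mul_self_nonneg Z
  have hD : Uᴴ * (Zᴴ * Z) * U = Matrix.diagonal fun i => (μ i : ℂ) := by
    conv_lhs => rw [hH.spectral_theorem, Unitary.conjStarAlgAut_apply]
    change Uᴴ * (U * Matrix.diagonal (fun i => (μ i : ℂ)) * Uᴴ) * U = _
    calc Uᴴ * (U * Matrix.diagonal (fun i => (μ i : ℂ)) * Uᴴ) * U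
        = (Uᴴ * U) * Matrix.diagonal (fun i => (μ i : ℂ)) * (Uᴴ * U) := by
          simp only [Matrix.mul_assoc]
      _ = _ := by rw [hUU, Matrix.one_mul, Matrix.mul_one]
  -- Since `0⁻¹ = 0`, the diagonal matrix `d` is the pseudo-inverse of `D^{1/2}`.
  let d : n → ℂ := fun i => ((√(μ i))⁻¹ : ℝ)
  let W : Matrix n n ℂ := Z * U * Matrix.diagonal d
  have hd : (Matrix.diagonal d)ᴴ = Matrix.diagonal d := by
    rw [Matrix.diagonal_conjTranspose]
    congr 1
    ext i
    exact Complex.conj_ofReal _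
  have htr : (Wᴴ * Z * U).trace = (traceNorm Z : ℂ) := by
    have : Wᴴ * Z * U = Matrix.diagonal fun i => ((√(μ i) : ℝ) : ℂ) := by
      calc Wᴴ * Z * U = Matrix.diagonal d * (Uᴴ * (Zᴴ * Z) * U) := by
            simp only [W, Matrix.conjTranspose_mul, hd, Matrix.mul_assoc]
        _ = _ := by
            rw [hD, Matrix.diagonal_mul_diagonal]
            congr 1
            ext i
            simp only [d]
            rw [← Complex.ofReal_mul, inv_mul_eq_div, Real.div_sqrt]
    rw [this, Matrix.trace_diagonal, traceNorm]
    push_cast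
    rfl
  -- `W` is a partial isometry.
  have hWW : W * (Wᴴ * W) = W := by
    have h1 : Wᴴ * W = Matrix.diagonal fun i => d i * (μ i * d i) := by
      calc Wᴴ * W = Matrix.diagonal d * ((Uᴴ * (Zᴴ * Z) * U) * Matrix.diagonal d) := by
            simp only [W, Matrix.conjTranspose_mul, hd, Matrix.mul_assoc]
        _ = _ := by rw [hD, Matrix.diagonal_mul_diagonal, Matrix.diagonal_mul_diagonal]
    rw [h1]
    simp only [W]
    rw [Matrix.mul_assoc, Matrix.diagonal_mul_diagonal]
    congr 2
    ext i
    simp only [d]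
    norm_cast
    rcases (hμ i).eq_or_lt with h | h
    · simp [← h]
    · have h2 : √(μ i) ≠ 0 := (Real.sqrt_pos.2 h).ne'
      have h3 : √(μ i) * √(μ i) = μ i := Real.mul_self_sqrt h.le
      field_simp
      nlinarith
  have hn1 : ‖vec (Pᴴ * W)‖ ≤ ‖vec P‖ := by
    let R := W * Wᴴ
    have hRR : R * R = R := by
      change W * Wᴴ * (W * Wᴴ) = W * Wᴴ
      rw [← Matrix.mul_assoc, Matrix.mul_assoc W, hWW]
    have hRH : Rᴴ = R := by simp [R]
    have e1 : ‖vec (Pᴴ * W)‖ ^ 2 = (Pᴴ * R * P).trace.re := by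
      rw [norm_vec_sq, Matrix.conjTranspose_mul, Matrix.conjTranspose_conjTranspose,
        Matrix.trace_mul_comm]
      simp only [R, Matrix.mul_assoc]
    have e2 : ‖vec (P - R * P)‖ ^ 2 = (Pᴴ * P).trace.re - (Pᴴ * R * P).trace.re := by
      rw [norm_vec_sq, ← Complex.sub_re, ← Matrix.trace_sub]
      congr 2
      simp only [Matrix.conjTranspose_sub, Matrix.conjTranspose_mul, hRH]
      have : Pᴴ * R * (R * P) = Pᴴ * R * P := by
        rw [← Matrix.mul_assoc, Matrix.mul_assoc Pᴴ, hRR]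
      rw [sub_mul, mul_sub, mul_sub, this]
      simp only [Matrix.mul_assoc]
      abel
    rw [← sq_le_sq₀ (norm_nonneg _) (norm_nonneg _), e1, norm_vec_sq P]
    linarith [sq_nonneg ‖vec (P - R * P)‖]
  have hn2 : ‖vec (Q * U)‖ = ‖vec Q‖ := by
    rw [← sq_eq_sq₀ (norm_nonneg _) (norm_nonneg _), norm_vec_sq, norm_vec_sq,
      Matrix.conjTranspose_mul, Matrix.mul_assoc, Matrix.trace_mul_comm]
    simp only [Matrix.mul_assoc, hUU', Matrix.mul_one]
  have hin : inner ℂ (vec (Pᴴ * W)) (vec (Q * U)) = (traceNorm Z : ℂ) := by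
    rw [inner_vec, ← htr, hZ]
    simp only [Matrix.conjTranspose_mul, Matrix.conjTranspose_conjTranspose, Matrix.mul_assoc]
  have hcs := norm_inner_le_norm (𝕜 := ℂ) (vec (Pᴴ * W)) (vec (Q * U))
  rw [hin, hn2, Complex.norm_real] at hcs
  calc traceNorm Z ≤ ‖traceNorm Z‖ := Real.le_norm_self _
    _ ≤ _ := hcs
    _ ≤ _ := mul_le_mul_of_nonneg_right hn1 (norm_nonneg _)

end MatrixAnalysis

section LogSobolev
open Filter Topology

/-! ### The modified logarithmic Sobolev inequality -/

section

variable {n : Type} [Fintype n]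

theorem trace_mul_fixedExp {A : SuperOp n} {ρ w : Matrix n n ℂ} (hρ : ρ.IsHermitian)
    (hσ : (fixedExp A ρ).IsHermitian) (hw : w ∈ fixedPoints A) :
    (ρ * w).trace = (fixedExp A ρ * w).trace := by
  have h := trace_fixedExp_conjTranspose_mul ρ hw
  rw [hρ.eq, hσ.eq] at h
  exact h.symm

variable [DecidableEq n]

/-- The kernel projection of `E_N(ρ)` lies in `N`, hence is orthogonal to `ρ`. -/
theorem mulVec_eq_zero_of_fixedExp {A : SuperOp n} (h1 : 1 ∈ fixedPoints A)
    (hm : ∀ x ∈ fixedPoints A, ∀ y ∈ fixedPoints A, x * y ∈ fixedPoints A) {ρ : Matrix n n ℂ}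
    (hρ : ρ.PosSemidef) (hσ : (fixedExp A ρ).IsHermitian) {v : n → ℂ}
    (hv : fixedExp A ρ *ᵥ v = 0) : ρ *ᵥ v = 0 := by
  set σ := fixedExp A ρ with hσdef
  -- Since `0⁻¹ = 0`, the function `1 - x⁻¹ x` is the indicator of `0`.
  let p := cfc (fun x : ℝ => 1 - x⁻¹ * x) σ
  have hsa : IsSelfAdjoint σ := hσ
  have hpN : p ∈ fixedPoints A := cfc_mem_of_mul_mem h1 hm hσ (fixedExp_mem A ρ) _
  have hp : p = 1 - cfc (fun x : ℝ => x⁻¹) σ * σ := by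
    have h2 : cfc (fun x : ℝ => x⁻¹ * x) σ = cfc (fun x : ℝ => x⁻¹) σ * σ := by
      rw [← cfc_mul_cfc (fun x : ℝ => x⁻¹) (fun x => x), cfc_id' ℝ σ]
    rw [← h2, ← cfc_const_one ℝ σ,
      ← cfc_sub _ _ σ (continuousOn_spectrum _ σ) (continuousOn_spectrum _ σ)]
  have hpv : p *ᵥ v = v := by
    rw [hp, Matrix.sub_mulVec, Matrix.one_mulVec, ← Matrix.mulVec_mulVec, hv, Matrix.mulVec_zero,
      sub_zero]
  have hpp : p * p = p := by
    simp only [p]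
    rw [cfc_mul_cfc]
    congr 1
    ext x
    by_cases hx : x = 0 <;> simp [hx]
  have hph : pᴴ = p := (isHermitian_cfc _ σ).eq
  have hσp : σ * p = 0 := by
    simp only [p]
    rw [mul_cfc hσ]
    have : (fun x : ℝ => x * (1 - x⁻¹ * x)) = fun _ => 0 := by
      ext x
      by_cases hx : x = 0 <;> simp [hx]
    rw [this, cfc_const_zero]
  obtain ⟨s, hs⟩ := (posSemidef_iff_conjTranspose_mul _).1 hρ
  have htr : ((s * p)ᴴ * (s * p)).trace = 0 := by
    have h3 := trace_mul_fixedExp hρ.isHermitian hσ hpN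
    rw [← hσdef, hσp, Matrix.trace_zero] at h3
    calc ((s * p)ᴴ * (s * p)).trace = (p * (ρ * p)).trace := by
          rw [hs, Matrix.conjTranspose_mul, hph]
          simp only [Matrix.mul_assoc]
      _ = (ρ * (p * p)).trace := by rw [Matrix.trace_mul_comm, Matrix.mul_assoc]
      _ = 0 := by rw [hpp, h3]
  have hsp : s * p = 0 := Matrix.trace_conjTranspose_mul_self_eq_zero_iff.1 htr
  rw [← hpv, Matrix.mulVec_mulVec, hs, Matrix.mul_assoc, hsp, Matrix.mul_zero, Matrix.zero_mulVec]

/-- If `A = λ (I - E_N) + (κ I - Ψ)` with `Ψ` positive, symmetric and `Ψ(1) = κ 1`, then `A`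
satisfies `λ`-FLSI: the second term contributes a nonnegative entropy production, and the entropy
production of `I - E_N` dominates the relative entropy by Klein's inequality. -/
theorem flsi_of_decomposition {A Ψ : SuperOp n} {lam κ : ℝ} (hlam : 0 ≤ lam)
    (h1 : 1 ∈ fixedPoints A)
    (hm : ∀ x ∈ fixedPoints A, ∀ y ∈ fixedPoints A, x * y ∈ fixedPoints A)
    (hE : ∀ x : Matrix n n ℂ, x.PosSemidef → (fixedExp A x).PosSemidef)
    (hΨ : ∀ x : Matrix n n ℂ, x.PosSemidef → (Ψ x).PosSemidef) (hΨ1 : Ψ 1 = (κ : ℂ) • 1)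
    (hΨs : IsSelfAdjoint (toL2 Ψ))
    (hA : A = (lam : ℂ) • (LinearMap.id - fixedExp A) + ((κ : ℂ) • LinearMap.id - Ψ)) :
    FLSI lam A := by
  intro ρ hρ
  have hσ := hE ρ hρ
  set σ := fixedExp A ρ with hσdef
  have htr : ∀ w ∈ fixedPoints A, (ρ * w).trace = (σ * w).trace :=
    fun w hw => trace_mul_fixedExp hρ.isHermitian hσ.isHermitian hw
  have hlog : cfc Real.log σ ∈ fixedPoints A :=
    cfc_mem_of_mul_mem h1 hm hσ.isHermitian (fixedExp_mem A ρ) _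
  have htr1 : σ.trace = ρ.trace := by simpa using (htr 1 h1).symm
  rw [relEntropy, if_pos fun v hv => mulVec_eq_zero_of_fixedExp h1 hm hρ hσ.isHermitian hv,
    htr _ hlog, Complex.sub_re, ← EReal.coe_mul, fisherInfo]
  have hlim := (((tendsto_trace_mul_log hρ).sub (tendsto_trace_mul_log hσ)).const_mul lam)
  have hlim' := (continuous_coe_real_ereal.tendsto _).comp hlim
  rw [← hlim'.liminf_eq]
  refine liminf_le_liminf ?_
  filter_upwards [self_mem_nhdsWithin] with δ hδ
  have hδ' : (0 : ℝ) < δ := hδ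
  rw [Function.comp_apply, EReal.coe_le_coe_iff]
  have hpd : ((δ : ℂ) • (1 : Matrix n n ℂ)).PosDef :=
    Matrix.PosDef.one.smul (Complex.zero_lt_real.2 hδ')
  have hklein := re_trace_mul_log_le (Matrix.PosDef.posSemidef_add hσ hpd)
    (Matrix.PosDef.posSemidef_add hρ hpd) (by rw [Matrix.trace_add, Matrix.trace_add, htr1])
  have hmono : MonotoneOn (fun x => Real.log (x + δ)) (Set.Ici 0) := by
    intro x hx y _ hxy
    have : (0 : ℝ) ≤ x := hx
    exact Real.log_le_log (by linarith) (by linarith)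
  have hprod := entropyProduction_nonneg hΨ hΨ1 hΨs hρ hmono
  rw [← cfc_add_smul_one hρ.isHermitian] at hprod
  have hAρ : A ρ = (lam : ℂ) • ((ρ + (δ : ℂ) • 1) - (σ + (δ : ℂ) • 1)) + ((κ : ℂ) • ρ - Ψ ρ) := by
    conv_lhs => rw [hA]
    simp [hσdef]
  rw [hAρ]
  generalize ρ + (δ : ℂ) • 1 = ρδ at *
  generalize σ + (δ : ℂ) • 1 = σδ at *
  rw [add_mul, Matrix.trace_add, Complex.add_re, Matrix.smul_mul, Matrix.trace_smul,
    smul_eq_mul, Complex.re_ofReal_mul, sub_mul ρδ, Matrix.trace_sub, Complex.sub_re]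
  have := mul_le_mul_of_nonneg_left hklein hlam
  linarith

end

variable {ι : Type} [Fintype ι] [DecidableEq ι]

theorem clsi_of_decomposition {A Ψ : SuperOp ι} {lam κ : ℝ} (hlam : 0 ≤ lam) (hA : IsGenerator A)
    (hΨ : IsCompletelyPositive Ψ) (hΨ1 : Ψ 1 = (κ : ℂ) • 1) (hΨs : IsSelfAdjoint (toL2 Ψ))
    (h : A = (lam : ℂ) • (LinearMap.id - fixedExp A) + ((κ : ℂ) • LinearMap.id - Ψ)) :
    CLSI lam A := by
  intro k
  refine flsi_of_decomposition (Ψ := amplify k Ψ) (κ := κ) hlam ?_ ?_ ?_ (fun X hX => hΨ k X hX)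
    (amplify_one hΨ1) (isSelfAdjoint_toL2_amplify hΨs k) ?_
  · rw [fixedPoints_amplify]
    intro i j
    rw [block_one]
    split_ifs
    · exact one_mem_fixedPoints hA
    · exact Submodule.zero_mem _
  · intro X hX Y hY
    rw [fixedPoints_amplify] at hX hY ⊢
    intro i j
    rw [block_mul]
    exact Submodule.sum_mem _ fun l _ => mul_mem_fixedPoints hA (hX i l) (hY l j)
  · intro X hX
    rw [fixedExp_amplify]
    exact (isMarkov_fixedExp hA).completelyPositive k X hX
  · rw [fixedExp_amplify]
    conv_lhs => rw [h]
    simp only [amplify_add, amplify_smul, amplify_sub, amplify_id]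

end LogSobolev

section ReturnTime
open Filter Topology

variable {ι : Type} [Fintype ι]

/-! ### Finiteness of the return time -/

theorem norm_entry_le_traceNorm [DecidableEq ι] (X : Matrix ι ι ℂ) (p q : ι) :
    ‖X p q‖ ≤ traceNorm X :=
  (PiLp.norm_apply_le (WithLp.toLp 2 fun p : ι × ι => X p.1 p.2 : EuclideanSpace ℂ (ι × ι))
    (p, q)).trans (norm_vec_le_traceNorm X)

theorem norm_vec_sq_eq_sum (X : Matrix ι ι ℂ) : ‖vec X‖ ^ 2 = ∑ p, ∑ q, ‖X p q‖ ^ 2 := by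
  rw [← Fintype.sum_prod_type' (f := fun p q => ‖X p q‖ ^ 2)]
  exact EuclideanSpace.norm_sq_eq
    (WithLp.toLp 2 fun p : ι × ι => X p.1 p.2 : EuclideanSpace ℂ (ι × ι))

variable [DecidableEq ι]

/-- Testing the mixed norm on `a, b ∈ M_k ⊗ 1` of rank one bounds the operator norm of every slice
`(X_{(i,p),(j,q)})_{ij}`. -/
theorem norm_slice_le {N : Submodule ℂ (Matrix ι ι ℂ)} (h1 : 1 ∈ N) {k : ℕ}
    {X : Matrix (Fin k × ι) (Fin k × ι) ℂ} (hX : mixedNorm N X ≤ 1) {u w : Fin k → ℂ}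
    (hu : ∑ i, ‖u i‖ ^ 2 ≤ 1) (hw : ∑ i, ‖w i‖ ^ 2 ≤ 1) (p q : ι) :
    ‖∑ i, ∑ j, star (u i) * X (i, p) (j, q) * w j‖ ≤ Fintype.card ι := by
  rcases isEmpty_or_nonempty (Fin k) with hk | ⟨⟨i₀⟩⟩
  · simp
  have hcard : (0 : ℝ) < Fintype.card ι := Nat.cast_pos.2 (Fintype.card_pos_iff.2 ⟨p⟩)
  let c : ℝ := (√(Fintype.card ι))⁻¹
  have hc : c ^ 2 * Fintype.card ι = 1 := by
    simp only [c]
    rw [inv_pow, Real.sq_sqrt hcard.le, inv_mul_cancel₀ hcard.ne']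
  let a : Matrix (Fin k × ι) (Fin k × ι) ℂ := Matrix.of fun x y =>
    if x.1 = i₀ then (if x.2 = y.2 then (c : ℂ) * star (u y.1) else 0) else 0
  let b : Matrix (Fin k × ι) (Fin k × ι) ℂ := Matrix.of fun x y =>
    if y.1 = i₀ then (if x.2 = y.2 then (c : ℂ) * w x.1 else 0) else 0
  have haN : ∀ i j, block a i j ∈ N := by
    intro i j
    have : block a i j = (if i = i₀ then (c : ℂ) * star (u j) else 0) • 1 := by
      ext p q
      by_cases h : i = i₀ <;> by_cases h' : p = q <;> simp [block, a, h, h']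
    rw [this]
    exact N.smul_mem _ h1
  have hbN : ∀ i j, block b i j ∈ N := by
    intro i j
    have : block b i j = (if j = i₀ then (c : ℂ) * w i else 0) • 1 := by
      ext p q
      by_cases h : j = i₀ <;> by_cases h' : p = q <;> simp [block, b, h, h']
    rw [this]
    exact N.smul_mem _ h1
  have hcc : ‖(c : ℂ)‖ ^ 2 = c ^ 2 := by rw [Complex.norm_real, Real.norm_eq_abs, sq_abs]
  have ha : ‖vec a‖ ≤ 1 := by
    rw [← sq_le_one_iff₀ (norm_nonneg _), norm_vec_sq_eq_sum]
    have : ∑ x, ∑ y, ‖a x y‖ ^ 2 = ∑ j, ‖u j‖ ^ 2 := by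
      simp only [a, Matrix.of_apply, Fintype.sum_prod_type, apply_ite norm, norm_zero, ite_pow,
        norm_mul, mul_pow, hcc, norm_star]
      simp [← Finset.mul_sum, mul_comm _ (c ^ 2), ← mul_assoc]
      rw [hc, one_mul]
    rwa [this]
  have hb : ‖vec b‖ ≤ 1 := by
    rw [← sq_le_one_iff₀ (norm_nonneg _), norm_vec_sq_eq_sum, Finset.sum_comm]
    have : ∑ y, ∑ x, ‖b x y‖ ^ 2 = ∑ j, ‖w j‖ ^ 2 := by
      simp only [b, Matrix.of_apply, Fintype.sum_prod_type, apply_ite norm, norm_zero, ite_pow,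
        norm_mul, mul_pow, hcc]
      simp [← Finset.mul_sum, mul_comm _ (c ^ 2), ← mul_assoc]
      rw [hc, one_mul]
    rwa [this]
  simp only [mixedNorm, iSup_le_iff] at hX
  have hle : ENNReal.ofReal (traceNorm (a * X * b)) ≤ 1 := hX a b ⟨haN, ha⟩ ⟨hbN, hb⟩
  have hle' : traceNorm (a * X * b) ≤ 1 := by simpa using hle
  have hentry : (a * X * b) (i₀, p) (i₀, q) =
      (c : ℂ) ^ 2 * ∑ i, ∑ j, star (u i) * X (i, p) (j, q) * w j := by
    simp only [Matrix.mul_apply, a, b, Matrix.of_apply, Fintype.sum_prod_type, if_true]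
    simp only [ite_mul, mul_ite, zero_mul, mul_zero, Finset.sum_ite_eq, Finset.sum_ite_eq',
      Finset.mem_univ, if_true, Finset.sum_mul, Finset.mul_sum]
    rw [Finset.sum_comm]
    refine Finset.sum_congr rfl fun i _ => Finset.sum_congr rfl fun j _ => ?_
    ring
  have h3 := (norm_entry_le_traceNorm (a * X * b) (i₀, p) (i₀, q)).trans hle'
  rw [hentry, norm_mul, norm_pow, hcc] at h3
  have hc2 : c ^ 2 = (Fintype.card ι : ℝ)⁻¹ := eq_inv_of_mul_eq_one_left hc
  rwa [hc2, inv_mul_le_iff₀ hcard, mul_one] at h3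

theorem norm_le_of_forall_unit {n : Type} [Fintype n] [DecidableEq n] {M : Matrix n n ℂ} {C : ℝ}
    (hC : 0 ≤ C) (h : ∀ ξ η : n → ℂ, ∑ i, ‖ξ i‖ ^ 2 ≤ 1 → ∑ i, ‖η i‖ ^ 2 ≤ 1 →
      ‖star ξ ⬝ᵥ (M *ᵥ η)‖ ≤ C) :
    ‖Matrix.toEuclideanCLM (𝕜 := ℂ) M‖ ≤ C := by
  refine ContinuousLinearMap.opNorm_le_of_unit_norm hC fun x hx => ?_
  set y := Matrix.toEuclideanCLM (𝕜 := ℂ) M x with hy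
  by_cases hy0 : y = 0
  · simpa [hy0] using hC
  have hny : ‖y‖ ≠ 0 := norm_ne_zero_iff.2 hy0
  let z : EuclideanSpace ℂ n := ((‖y‖⁻¹ : ℝ) : ℂ) • y
  have hz : ‖z‖ = 1 := by
    simp only [z]
    rw [norm_smul, Complex.norm_real, norm_inv, norm_norm, inv_mul_cancel₀ hny]
  have h1 := h (WithLp.ofLp z) (WithLp.ofLp x)
    (by rw [← EuclideanSpace.norm_sq_eq, hz]; norm_num)
    (by rw [← EuclideanSpace.norm_sq_eq, hx]; norm_num)
  have h2 : star (WithLp.ofLp z) ⬝ᵥ (M *ᵥ WithLp.ofLp x) = inner ℂ z y := by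
    rw [EuclideanSpace.inner_eq_star_dotProduct, dotProduct_comm]
    rfl
  have h3 : inner ℂ z y = (‖y‖ : ℂ) := by
    simp only [z]
    rw [inner_smul_left, inner_self_eq_norm_sq_to_K, Complex.conj_ofReal]
    have : (‖y‖ : ℂ) ≠ 0 := by exact_mod_cast hny
    simp only [Complex.ofReal_inv, Complex.coe_algebraMap]
    field_simp
  rw [h2, h3, Complex.norm_real, norm_norm] at h1
  exact h1

/-- A crude bound for the completely bounded norm `L_∞^1(N ⊂ M) → L_∞(M)` by matrix entries. -/
theorem cbNormOneInf_le {N : Submodule ℂ (Matrix ι ι ℂ)} (h1 : 1 ∈ N) (Φ : SuperOp ι) :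
    cbNormOneInf N Φ ≤ ENNReal.ofReal
      (∑ p', ∑ q', ∑ p, ∑ q, ‖Φ (Matrix.single p q 1) p' q'‖ * Fintype.card ι) := by
  refine iSup_le fun k => iSup_le fun X => iSup_le fun hX => ENNReal.ofReal_le_ofReal ?_
  refine norm_le_of_forall_unit ?_ fun ξ η hξ hη => ?_
  · positivity
  have hs : ∀ (ξ : Fin k × ι → ℂ) (p : ι), ∑ i, ‖ξ i‖ ^ 2 ≤ 1 → ∑ i, ‖ξ (i, p)‖ ^ 2 ≤ 1 := by
    intro ξ p hξ
    refine le_trans ?_ hξ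
    rw [Fintype.sum_prod_type]
    exact Finset.sum_le_sum fun i _ =>
      Finset.single_le_sum (f := fun p => ‖ξ (i, p)‖ ^ 2) (fun _ _ => sq_nonneg _)
        (Finset.mem_univ p)
  have hblock : ∀ i j p' q', Φ (block X i j) p' q' =
      ∑ p, ∑ q, X (i, p) (j, q) * Φ (Matrix.single p q 1) p' q' := by
    intro i j p' q'
    have hx : block X i j = ∑ p, ∑ q, X (i, p) (j, q) • Matrix.single p q (1 : ℂ) := by
      conv_lhs => rw [Matrix.matrix_eq_sum_single (block X i j)]
      simp [Matrix.smul_single, block]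
    rw [hx]
    simp only [map_sum, map_smul, Matrix.sum_apply, Matrix.smul_apply, smul_eq_mul]
  have key : star ξ ⬝ᵥ (amplify k Φ X *ᵥ η) = ∑ p', ∑ q', ∑ p, ∑ q, Φ (Matrix.single p q 1) p' q' *
      ∑ i, ∑ j, star (ξ (i, p')) * X (i, p) (j, q) * η (j, q') := by
    simp only [dotProduct, Matrix.mulVec, amplify_apply, hblock, Fintype.sum_prod_type,
      Finset.mul_sum, Finset.sum_mul, Pi.star_apply]
    rw [Finset.sum_comm]
    refine Finset.sum_congr rfl fun p' _ => ?_
    simp only [Finset.sum_comm (γ := Fin k) (α := ι)]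
    refine Finset.sum_congr rfl fun q' _ => ?_
    refine Finset.sum_congr rfl fun p _ => ?_
    refine Finset.sum_congr rfl fun q _ => ?_
    refine Finset.sum_congr rfl fun i _ => ?_
    refine Finset.sum_congr rfl fun j _ => ?_
    ring
  rw [key]
  refine (norm_sum_le _ _).trans (Finset.sum_le_sum fun p' _ => ?_)
  refine (norm_sum_le _ _).trans (Finset.sum_le_sum fun q' _ => ?_)
  refine (norm_sum_le _ _).trans (Finset.sum_le_sum fun p _ => ?_)
  refine (norm_sum_le _ _).trans (Finset.sum_le_sum fun q _ => ?_)
  rw [norm_mul]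
  exact mul_le_mul_of_nonneg_left (norm_slice_le h1 hX (hs ξ p' hξ) (hs η q' hη) p q)
    (norm_nonneg _)

theorem returnTimes_nonempty {A : SuperOp ι} (hA : IsGenerator A) : (returnTimes A).Nonempty := by
  have hent : ∀ (x : Matrix ι ι ℂ) (p q : ι),
      Tendsto (fun t => (semigroup A t - fixedExp A) x p q) atTop (𝓝 0) := by
    intro x p q
    let f : HS ι →L[ℂ] ℂ := EuclideanSpace.proj (p, q)
    have h := (tendsto_semigroup hA).sub_const (toL2 (fixedExp A))
    rw [sub_self] at h
    have hc : Continuous fun S : HS ι →L[ℂ] HS ι => f (S (vec x)) := by fun_prop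
    have h2 := (hc.tendsto 0).comp h
    rw [zero_apply, map_zero] at h2
    exact h2
  have hlim : Tendsto (fun t => ∑ p', ∑ q', ∑ p, ∑ q,
      ‖(semigroup A t - fixedExp A) (Matrix.single p q 1) p' q'‖ * (Fintype.card ι : ℝ))
      atTop (𝓝 0) := by
    have : (0 : ℝ) = ∑ p' : ι, ∑ q' : ι, ∑ p : ι, ∑ q : ι, ‖(0 : ℂ)‖ * (Fintype.card ι : ℝ) := by
      simp
    rw [this]
    refine tendsto_finsetSum _ fun p' _ => tendsto_finsetSum _ fun q' _ =>
      tendsto_finsetSum _ fun p _ => tendsto_finsetSum _ fun q _ => ?_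
    exact ((hent _ p' q').norm).mul_const _
  obtain ⟨t, ht, ht0⟩ := ((hlim.eventually (eventually_le_nhds (b := 1 / 2) (by norm_num))).and
    (eventually_ge_atTop 0)).exists
  refine ⟨t, ht0, (cbNormOneInf_le (one_mem_fixedPoints hA) _).trans ?_⟩
  rw [ENNReal.ofReal_le_iff_le_toReal (by simp)]
  simpa using ht

end ReturnTime

section Minorization
open Filter Topology

/-! ### Times beyond the return time dominate the conditional expectation -/

open scoped Matrix.Norms.L2Operator MatrixOrder in
theorem posSemidef_add_smul_one_of_norm_le {n : Type} [Fintype n] [DecidableEq n]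
    {M : Matrix n n ℂ} (hM : M.IsHermitian) {C : ℝ}
    (h : ‖Matrix.toEuclideanCLM (𝕜 := ℂ) M‖ ≤ C) : (M + (C : ℂ) • 1).PosSemidef := by
  have h1 := IsSelfAdjoint.neg_algebraMap_norm_le_self (a := M) hM
  rw [neg_le_iff_add_nonneg, Matrix.nonneg_iff_posSemidef, Algebra.algebraMap_eq_smul_one,
    ← Complex.coe_smul] at h1
  have h2 : ‖M‖ ≤ C := h
  have h3 : M + (C : ℂ) • 1 = (M + (‖M‖ : ℂ) • 1) + ((C - ‖M‖ : ℝ) : ℂ) • 1 := by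
    push_cast
    rw [sub_smul]
    abel
  rw [h3]
  exact h1.add (Matrix.PosSemidef.one.smul (Complex.zero_le_real.2 (sub_nonneg.2 h2)))

variable {ι : Type} [Fintype ι] [DecidableEq ι]

theorem IsMarkov.amplify_map_mul_left {Φ : SuperOp ι} (h : IsMarkov Φ) {k : ℕ}
    {a : Matrix (Fin k × ι) (Fin k × ι) ℂ} (ha : ∀ i j, Φ (block a i j) = block a i j)
    (X : Matrix (Fin k × ι) (Fin k × ι) ℂ) : amplify k Φ (a * X) = a * amplify k Φ X := by
  apply ext_block
  intro i j
  simp only [block_amplify, block_mul, map_sum, h.map_mul_left (ha _ _)]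

theorem IsMarkov.amplify_map_mul_right {Φ : SuperOp ι} (h : IsMarkov Φ) {k : ℕ}
    {a : Matrix (Fin k × ι) (Fin k × ι) ℂ} (ha : ∀ i j, Φ (block a i j) = block a i j)
    (X : Matrix (Fin k × ι) (Fin k × ι) ℂ) : amplify k Φ (X * a) = amplify k Φ X * a := by
  apply ext_block
  intro i j
  simp only [block_amplify, block_mul, map_sum, h.map_mul_right (ha _ _)]

/-- A positive `Y = s^* s` with `E_N(Y) ≤ 1` lies in the unit ball of `L_∞^1(N ⊂ M)`:
`‖c Y d‖_1 ≤ ‖c s^*‖_2 ‖s d‖_2`, and `‖s d‖_2² = tr(E_N(Y) d d^*)`. -/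
theorem mixedNorm_le_one {A : SuperOp ι} (hA : IsGenerator A) {k : ℕ}
    {Y : Matrix (Fin k × ι) (Fin k × ι) ℂ} (hY : Y.PosSemidef)
    (hEY : (1 - amplify k (fixedExp A) Y).PosSemidef) : mixedNorm (fixedPoints A) Y ≤ 1 := by
  have hEH : (fixedExp (amplify k A) Y).IsHermitian := by
    rw [fixedExp_amplify]
    exact ((isMarkov_fixedExp hA).completelyPositive k Y hY).isHermitian
  have hmem : ∀ c : Matrix (Fin k × ι) (Fin k × ι) ℂ, (∀ i j, block c i j ∈ fixedPoints A) →
      c * cᴴ ∈ fixedPoints (amplify k A) := by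
    intro c hc
    rw [fixedPoints_amplify]
    intro i j
    rw [block_mul]
    refine Submodule.sum_mem _ fun l _ => mul_mem_fixedPoints hA (hc i l) ?_
    rw [block_conjTranspose]
    exact conjTranspose_mem_fixedPoints hA (hc j l)
  obtain ⟨s, hs⟩ := (posSemidef_iff_conjTranspose_mul _).1 hY
  have key : ∀ d : Matrix (Fin k × ι) (Fin k × ι) ℂ, (∀ i j, block d i j ∈ fixedPoints A) →
      ‖vec d‖ ≤ 1 → ‖vec (s * d)‖ ≤ 1 := by
    intro d hd hd1
    have e1 : ‖vec (s * d)‖ ^ 2 = (amplify k (fixedExp A) Y * (d * dᴴ)).trace.re := by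
      rw [← fixedExp_amplify, ← trace_mul_fixedExp hY.isHermitian hEH (hmem d hd), norm_vec_sq, hs,
        Matrix.conjTranspose_mul, Matrix.mul_assoc, Matrix.trace_mul_comm]
      simp only [Matrix.mul_assoc]
    have e2 : ‖vec d‖ ^ 2 = (d * dᴴ).trace.re := by
      rw [norm_vec_sq, Matrix.trace_mul_comm]
    have e3 := re_trace_mul_nonneg hEY (Matrix.posSemidef_self_mul_conjTranspose d)
    rw [sub_mul, Matrix.one_mul, Matrix.trace_sub, Complex.sub_re, ← e1, ← e2] at e3
    have e4 : ‖vec d‖ ^ 2 ≤ 1 := (sq_le_one_iff₀ (norm_nonneg _)).2 hd1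
    rw [← sq_le_one_iff₀ (norm_nonneg _)]
    linarith
  refine iSup_le fun a => iSup_le fun b => iSup_le fun ha => iSup_le fun hb => ?_
  rw [ENNReal.ofReal_le_one]
  have ha' : ‖vec (a * sᴴ)‖ ≤ 1 := by
    have h := key aᴴ (fun i j => by
      rw [block_conjTranspose]
      exact conjTranspose_mem_fixedPoints hA (ha.1 j i))
      (by rw [norm_vec_conjTranspose]; exact ha.2)
    rwa [← norm_vec_conjTranspose, Matrix.conjTranspose_mul,
      Matrix.conjTranspose_conjTranspose] at h
  have hb' := key b hb.1 hb.2
  calc traceNorm (a * Y * b) = traceNorm ((a * sᴴ) * (s * b)) := by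
        rw [hs]
        simp only [Matrix.mul_assoc]
    _ ≤ _ := traceNorm_mul_le _ _
    _ ≤ 1 := mul_le_one₀ ha' (norm_nonneg _) hb'

/-- If `‖T_t - E_N : L_∞^1(N ⊂ M) → L_∞(M)‖_cb ≤ 1/2` then `T_t - E_N / 2` is completely positive.
For `X ≥ 0` and `σ = E_N(X) + δ`, apply the norm bound to `σ^{-1/2} X σ^{-1/2}` and move the factors
`σ^{-1/2} ∈ N` out of `T_t - E_N`. -/
theorem isCompletelyPositive_semigroup_sub_of_mem_returnTimes {A : SuperOp ι} (hA : IsGenerator A)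
    {t : ℝ} (ht : t ∈ returnTimes A) :
    IsCompletelyPositive (semigroup A t - (1 / 2 : ℂ) • fixedExp A) := by
  intro k X hX
  have hT := hA.isMarkov ht.1
  have hE := isMarkov_fixedExp hA
  have hTX := hT.completelyPositive k X hX
  have hEX := hE.completelyPositive k X hX
  have hδ : ∀ δ : ℝ, 0 < δ → (amplify k (semigroup A t - (1 / 2 : ℂ) • fixedExp A) X +
      ((δ / 2 : ℝ) : ℂ) • 1).PosSemidef := by
    intro δ hδ
    set σ := amplify k (fixedExp A) X + (δ : ℂ) • 1 with hσdef
    have hσ : σ.PosDef := Matrix.PosDef.posSemidef_add hEX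
      (Matrix.PosDef.one.smul (Complex.zero_lt_real.2 hδ))
    have hσsa : IsSelfAdjoint σ := hσ.isHermitian
    have hσN : σ ∈ fixedPoints (amplify k A) := by
      refine Submodule.add_mem _ ?_ (Submodule.smul_mem _ _ ?_)
      · rw [← fixedExp_amplify]
        exact fixedExp_mem _ _
      · exact (fixedPoints_amplify A k 1).2 fun i j => by
          rw [block_one]
          split_ifs
          · exact one_mem_fixedPoints hA
          · exact Submodule.zero_mem _
    let a := cfc (fun x : ℝ => (√x)⁻¹) σ
    let b := cfc (fun x : ℝ => √x) σ
    have haN : a ∈ fixedPoints (amplify k A) := by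
      refine cfc_mem_of_mul_mem ?_ ?_ hσsa hσN _
      · refine (fixedPoints_amplify A k 1).2 fun i j => ?_
        rw [block_one]
        split_ifs
        · exact one_mem_fixedPoints hA
        · exact Submodule.zero_mem _
      · intro x hx y hy
        rw [fixedPoints_amplify] at hx hy ⊢
        intro i j
        rw [block_mul]
        exact Submodule.sum_mem _ fun l _ => mul_mem_fixedPoints hA (hx i l) (hy l j)
    rw [fixedPoints_amplify] at haN
    have haH : aᴴ = a := (isHermitian_cfc _ σ).eq
    have hbH : bᴴ = b := (isHermitian_cfc _ σ).eq
    have hspec : ∀ x ∈ spectrum ℝ σ, 0 < x := by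
      intro x hx
      rw [hσ.isHermitian.spectrum_real_eq_range_eigenvalues] at hx
      obtain ⟨i, rfl⟩ := hx
      exact hσ.eigenvalues_pos i
    have hab : a * b = 1 := by
      simp only [a, b]
      rw [cfc_mul_cfc, ← cfc_const_one ℝ σ]
      exact cfc_congr fun x hx => inv_mul_cancel₀ (Real.sqrt_pos.2 (hspec x hx)).ne'
    have hba : b * a = 1 := mul_eq_one_comm.1 hab
    have hbb : b * b = σ := by
      simp only [b]
      rw [cfc_mul_cfc]
      conv_rhs => rw [← cfc_id' ℝ σ]
      exact cfc_congr fun x hx => Real.mul_self_sqrt (hspec x hx).le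
    have haσa : a * σ * a = 1 := by
      rw [← hbb, ← Matrix.mul_assoc, hab, Matrix.one_mul, hba]
    have hmove : ∀ Φ : SuperOp ι, IsMarkov Φ → (∀ x ∈ fixedPoints A, Φ x = x) →
        amplify k Φ (a * X * a) = a * amplify k Φ X * a := by
      intro Φ hΦ hfix
      rw [hΦ.amplify_map_mul_right (fun i j => hfix _ (haN i j)),
        hΦ.amplify_map_mul_left (fun i j => hfix _ (haN i j))]
    have hTa := hmove _ hT fun x hx => hx t ht.1
    have hEa := hmove _ hE fun x hx => fixedExp_of_mem hx
    have hY : (a * X * a).PosSemidef := by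
      have := hX.conjTranspose_mul_mul_same a
      rwa [haH] at this
    have hEY : (1 - amplify k (fixedExp A) (a * X * a)).PosSemidef := by
      have : 1 - amplify k (fixedExp A) (a * X * a) = (δ : ℂ) • (aᴴ * a) := by
        rw [hEa, ← haσa, hσdef, haH]
        simp [mul_add, add_mul]
      rw [this]
      exact (Matrix.posSemidef_conjTranspose_mul_self a).smul (Complex.zero_le_real.2 hδ.le)
    have hnorm : ‖Matrix.toEuclideanCLM (𝕜 := ℂ)
        (amplify k (semigroup A t - fixedExp A) (a * X * a))‖ ≤ 1 / 2 := by
      have h := ht.2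
      simp only [cbNormOneInf, iSup_le_iff] at h
      have h2 := h k _ (mixedNorm_le_one hA hY hEY)
      have h3 := ENNReal.toReal_mono (by simp) h2
      rw [ENNReal.toReal_ofReal (norm_nonneg _)] at h3
      simpa using h3
    have hherm : (amplify k (semigroup A t - fixedExp A) (a * X * a)).IsHermitian :=
      (hT.completelyPositive k _ hY).isHermitian.sub (hE.completelyPositive k _ hY).isHermitian
    have hpos := (posSemidef_add_smul_one_of_norm_le hherm hnorm).conjTranspose_mul_mul_same b
    have hfin : bᴴ * (amplify k (semigroup A t - fixedExp A) (a * X * a) +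
        ((1 / 2 : ℝ) : ℂ) • 1) * b =
        amplify k (semigroup A t - (1 / 2 : ℂ) • fixedExp A) X + ((δ / 2 : ℝ) : ℂ) • 1 := by
      have e1 : amplify k (semigroup A t - fixedExp A) (a * X * a) =
          a * (amplify k (semigroup A t) X - amplify k (fixedExp A) X) * a := by
        rw [mul_sub, sub_mul, ← hTa, ← hEa]
        rfl
      have e2 : b * (a * (amplify k (semigroup A t) X - amplify k (fixedExp A) X) * a) * b =
          amplify k (semigroup A t) X - amplify k (fixedExp A) X := by
        calc _ = (b * a) * (amplify k (semigroup A t) X - amplify k (fixedExp A) X) * (a * b) := by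
              simp only [Matrix.mul_assoc]
          _ = _ := by rw [hab, hba, Matrix.one_mul, Matrix.mul_one]
      rw [hbH, e1, mul_add, add_mul, e2, Matrix.mul_smul, Matrix.mul_one, Matrix.smul_mul, hbb,
        hσdef, amplify_sub, amplify_smul, LinearMap.sub_apply, LinearMap.smul_apply]
      push_cast
      module
    rwa [hfin] at hpos
  rw [posSemidef_iff_forall_dotProduct]
  intro v
  set M := amplify k (semigroup A t - (1 / 2 : ℂ) • fixedExp A) X
  have hc : Continuous fun δ : ℝ => star v ⬝ᵥ ((M + ((δ / 2 : ℝ) : ℂ) • 1) *ᵥ v) := by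
    simp only [Matrix.add_mulVec, dotProduct_add, Matrix.smul_mulVec, dotProduct_smul]
    fun_prop
  have hlim := (hc.tendsto 0).mono_left (nhdsWithin_le_nhds (s := Set.Ioi 0))
  simp only [zero_div, Complex.ofReal_zero, zero_smul, add_zero] at hlim
  refine ge_of_tendsto hlim ?_
  filter_upwards [self_mem_nhdsWithin] with δ hδ'
  exact (hδ δ hδ').dotProduct_mulVec_nonneg v

theorem isCompletelyPositive_semigroup_sub {A : SuperOp ι} (hA : IsGenerator A) {s t : ℝ}
    (hs : s ∈ returnTimes A) (hst : s ≤ t) :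
    IsCompletelyPositive (semigroup A t - (1 / 2 : ℂ) • fixedExp A) := by
  have h : semigroup A t - (1 / 2 : ℂ) • fixedExp A =
      semigroup A (t - s) ∘ₗ (semigroup A s - (1 / 2 : ℂ) • fixedExp A) := by
    rw [LinearMap.comp_sub, ← semigroup_add, sub_add_cancel, LinearMap.comp_smul]
    congr 2
    ext1 x
    exact (fixedExp_mem A x _ (sub_nonneg.2 hst)).symm
  rw [h]
  exact (hA.isMarkov (sub_nonneg.2 hst)).completelyPositive.comp
    (isCompletelyPositive_semigroup_sub_of_mem_returnTimes hA hs)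

end Minorization

section Construction
open Filter Topology MeasureTheory

variable {ι : Type} [Fintype ι]

/-! ### Subordinated perturbations -/

theorem intervalIntegrable_semigroup (A : SuperOp ι) (a b : ℝ) :
    IntervalIntegrable (fun t => toL2 (semigroup A t)) volume a b :=
  (continuous_semigroup A).intervalIntegrable a b

/-- `(2/δ²) ∫_0^δ (I - T_t) dt → A` as `δ → 0`. -/
theorem exists_norm_sub_average_le (A : SuperOp ι) {η : ℝ} (hη : 0 < η) :
    ∃ δ : ℝ, 0 < δ ∧
      ‖toL2 A - (2 / δ ^ 2) • ∫ t in (0 : ℝ)..δ, (1 - toL2 (semigroup A t))‖ ≤ η := by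
  have h := (hasDerivAt_iff_isLittleO.1 (hasDerivAt_semigroup_zero A)).bound hη
  obtain ⟨r, hr, hb⟩ := Metric.eventually_nhds_iff.1 h
  have hδ : 0 < r / 2 := half_pos hr
  refine ⟨r / 2, hδ, ?_⟩
  set δ := r / 2 with hδdef
  have hbound : ∀ t ∈ Set.Ioc 0 δ, ‖t • toL2 A - (1 - toL2 (semigroup A t))‖ ≤ η * t := by
    intro t ht
    have h1 := hb (y := t) (by rw [Real.dist_eq, sub_zero, abs_of_pos ht.1]; linarith [ht.2])
    rw [semigroup_zero, toL2_id, sub_zero, smul_neg, Real.norm_of_nonneg ht.1.le] at h1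
    rwa [sub_neg_eq_add, sub_add_eq_add_sub, add_comm, ← sub_sub_eq_add_sub] at h1
  have hint := intervalIntegral.norm_integral_le_of_norm_le hδ.le
    (ae_of_all volume hbound) ((continuous_const.mul continuous_id).intervalIntegrable 0 δ)
  have hc : ∫ t in (0 : ℝ)..δ, (t • toL2 A - (1 - toL2 (semigroup A t))) =
      (δ ^ 2 / 2) • toL2 A - ∫ t in (0 : ℝ)..δ, (1 - toL2 (semigroup A t)) := by
    rw [intervalIntegral.integral_sub, intervalIntegral.integral_smul_const, integral_id]
    · simp
    · exact (continuous_id.smul continuous_const).intervalIntegrable _ _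
    · exact (continuous_const.sub (continuous_semigroup A)).intervalIntegrable _ _
  have hv : ∫ t in (0 : ℝ)..δ, η * t = η * (δ ^ 2 / 2) := by
    rw [intervalIntegral.integral_const_mul, integral_id]
    simp
  have hs : toL2 A - (2 / δ ^ 2) • ∫ t in (0 : ℝ)..δ, (1 - toL2 (semigroup A t)) =
      (2 / δ ^ 2) • ((δ ^ 2 / 2) • toL2 A - ∫ t in (0 : ℝ)..δ, (1 - toL2 (semigroup A t))) := by
    rw [smul_sub, smul_smul]
    have : 2 / δ ^ 2 * (δ ^ 2 / 2) = 1 := by field_simp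
    rw [this, one_smul]
  rw [hs, ← hc, norm_smul, Real.norm_of_nonneg (by positivity)]
  calc 2 / δ ^ 2 * _ ≤ 2 / δ ^ 2 * (η * (δ ^ 2 / 2)) := by
        refine mul_le_mul_of_nonneg_left ?_ (by positivity)
        rw [← hv]
        exact hint
    _ = η := by field_simp

variable [DecidableEq ι]

theorem isSelfAdjoint_integral_semigroup {A : SuperOp ι} (hA : IsGenerator A) {a b : ℝ}
    (ha : 0 ≤ a) (hab : a ≤ b) :
    IsSelfAdjoint (∫ t in a..b, toL2 (semigroup A t)) := by
  let f : (HS ι →L[ℂ] HS ι) →L[ℝ] (HS ι →L[ℂ] HS ι) := (starL' ℝ).toContinuousLinearMap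
  rw [IsSelfAdjoint]
  have h := f.intervalIntegral_comp_comm (intervalIntegrable_semigroup A a b)
  refine Eq.trans h.symm ?_
  refine intervalIntegral.integral_congr fun t ht => ?_
  rw [Set.uIcc_of_le hab] at ht
  exact (hA.isMarkov (ha.trans ht.1)).isSelfAdjoint

/-- The density with mass near `0`, which reproduces the generator, and a second bump of height `c`
beyond the time `s`. -/
noncomputable def twoBump (δ s c : ℝ) (t : ℝ) : ℝ :=
  (Set.Ioc 0 δ).indicator (fun _ => 2 / δ ^ 2) t + (Set.Ioc s (s + 1)).indicator (fun _ => c) t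

theorem integrable_indicator_Ioc_smul {E : Type*} [NormedAddCommGroup E] [NormedSpace ℝ E]
    {h : ℝ → E} (hh : Continuous h) (a b c : ℝ) :
    Integrable fun t => (Set.Ioc a b).indicator (fun _ => c) t • h t := by
  have : (fun t => (Set.Ioc a b).indicator (fun _ => c) t • h t) =
      (Set.Ioc a b).indicator fun t => c • h t := by
    ext t
    by_cases ht : t ∈ Set.Ioc a b <;> simp [ht]
  rw [this, integrable_indicator_iff measurableSet_Ioc]
  exact ((continuous_const.smul hh).integrableOn_Icc (a := a) (b := b)).mono_set
    Set.Ioc_subset_Icc_self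

theorem setIntegral_indicator_Ioc_smul {E : Type*} [NormedAddCommGroup E] [NormedSpace ℝ E]
    (h : ℝ → E) {a b : ℝ} (ha : 0 ≤ a) (hab : a ≤ b) (c : ℝ) :
    ∫ t in Set.Ioi 0, (Set.Ioc a b).indicator (fun _ => c) t • h t = c • ∫ t in a..b, h t := by
  have h1 : (fun t => (Set.Ioc a b).indicator (fun _ => c) t • h t) =
      (Set.Ioc a b).indicator fun t => c • h t := by
    ext t
    by_cases ht : t ∈ Set.Ioc a b <;> simp [ht]
  have h2 : Set.Ioi 0 ∩ Set.Ioc a b = Set.Ioc a b :=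
    Set.inter_eq_right.2 fun t ht => ha.trans_lt ht.1
  rw [h1, setIntegral_indicator measurableSet_Ioc, h2, integral_smul,
    intervalIntegral.integral_of_le hab]

/-- The perturbation `B = ∫ (I - T_t) g(t) dt` of `A`, with `g` a two-bump density, is close to `A`,
and the second bump contributes a multiple of `I - E_N` up to a completely positive remainder. -/
theorem exists_subordinated_generator {A : SuperOp ι} (hA : IsGenerator A) {s : ℝ}
    (hs : s ∈ returnTimes A) {c η : ℝ} (hc : 0 ≤ c) (hη : 0 < η) :
    ∃ (B Ψ : SuperOp ι) (F : ℝ → ℝ) (κ : ℝ), IsGenerator B ∧ IsSubordinated A B F ∧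
      ‖toL2 (A - B)‖ ≤ η + 2 * c ∧ IsCompletelyPositive Ψ ∧ Ψ 1 = (κ : ℂ) • 1 ∧
      IsSelfAdjoint (toL2 Ψ) ∧
      B = ((c / 2 : ℝ) : ℂ) • (LinearMap.id - fixedExp A) + ((κ : ℂ) • LinearMap.id - Ψ) := by
  obtain ⟨δ, hδ, hδη⟩ := exists_norm_sub_average_le A hη
  have hs0 : 0 ≤ s := hs.1
  let I₁ : HS ι →L[ℂ] HS ι := ∫ t in (0 : ℝ)..δ, toL2 (semigroup A t)
  let I₂ : HS ι →L[ℂ] HS ι := ∫ t in s..(s + 1), toL2 (semigroup A t)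
  let Q : HS ι →L[ℂ] HS ι := ((2 / δ ^ 2 : ℝ) : ℂ) • I₁ + (c : ℂ) • I₂
  have hsa : ∀ r : ℝ, IsSelfAdjoint (r : ℂ) := fun r => Complex.conj_ofReal r
  have hQs : IsSelfAdjoint Q :=
    ((hsa _).smul (isSelfAdjoint_integral_semigroup hA le_rfl hδ.le)).add
      ((hsa _).smul (isSelfAdjoint_integral_semigroup hA hs0 (by linarith)))
  have hδ2 : 0 ≤ 2 / δ ^ 2 := by positivity
  have hss : s ≤ s + 1 := by linarith
  have hI₁ : IsCompletelyPositive (ofL2 I₁) := by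
    simp only [I₁]
    rw [intervalIntegral.integral_of_le hδ.le]
    refine isCompletelyPositive_integral (intervalIntegrable_semigroup A 0 δ).1 ?_
    filter_upwards [ae_restrict_mem measurableSet_Ioc] with t ht
    exact (hA.isMarkov ht.1.le).completelyPositive
  have hI₂ : IsCompletelyPositive (ofL2 I₂ - (1 / 2 : ℂ) • fixedExp A) := by
    have h1 : ofL2 I₂ - (1 / 2 : ℂ) • fixedExp A =
        ofL2 (∫ t in s..(s + 1), toL2 (semigroup A t - (1 / 2 : ℂ) • fixedExp A)) := by
      apply toL2_injective
      rw [toL2_ofL2, toL2_sub, toL2_ofL2]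
      simp only [toL2_sub _ ((1 / 2 : ℂ) • fixedExp A)]
      rw [intervalIntegral.integral_sub (intervalIntegrable_semigroup A _ _)
        (continuous_const.intervalIntegrable _ _), intervalIntegral.integral_const]
      simp [I₂]
    rw [h1, intervalIntegral.integral_of_le hss]
    refine isCompletelyPositive_integral ?_ ?_
    · have hcont : Continuous fun t =>
          toL2 (semigroup A t) - toL2 ((1 / 2 : ℂ) • fixedExp A) :=
        (continuous_semigroup A).sub continuous_const
      exact (hcont.intervalIntegrable s (s + 1)).1
    · filter_upwards [ae_restrict_mem measurableSet_Ioc] with t ht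
      rw [ofL2_toL2]
      exact isCompletelyPositive_semigroup_sub hA hs ht.1.le
  have hone : ∀ a b : ℝ, 0 ≤ a → a ≤ b →
      (∫ t in a..b, toL2 (semigroup A t)) (vec 1) = ((b - a : ℝ) : ℂ) • vec 1 := by
    intro a b ha hab
    rw [ContinuousLinearMap.intervalIntegral_apply (intervalIntegrable_semigroup A a b)]
    have : ∀ t ∈ Set.uIcc a b, toL2 (semigroup A t) (vec 1) = vec 1 := by
      intro t ht
      rw [Set.uIcc_of_le hab] at ht
      rw [toL2_vec, (hA.isMarkov (ha.trans ht.1)).map_one]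
    rw [intervalIntegral.integral_congr this, intervalIntegral.integral_const, Complex.coe_smul]
  let κ : ℝ := 2 / δ ^ 2 * δ + c
  have hQ1 : Q (vec 1) = (κ : ℂ) • vec 1 := by
    simp only [Q, add_apply, smul_apply, I₁, I₂, hone 0 δ le_rfl hδ.le, hone s (s + 1) hs0 hss, κ]
    push_cast
    module
  let Ψ : SuperOp ι := ((2 / δ ^ 2 : ℝ) : ℂ) • ofL2 I₁ +
    (c : ℂ) • (ofL2 I₂ - (1 / 2 : ℂ) • fixedExp A)
  have hΨQ : Ψ = ofL2 Q - ((c / 2 : ℝ) : ℂ) • fixedExp A := by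
    have : ofL2 Q = ((2 / δ ^ 2 : ℝ) : ℂ) • ofL2 I₁ + (c : ℂ) • ofL2 I₂ := rfl
    rw [this]
    simp only [Ψ]
    push_cast
    module
  have hΨ : IsCompletelyPositive Ψ := (hI₁.smul hδ2).add (hI₂.smul hc)
  have hE1 : fixedExp A 1 = 1 := (isMarkov_fixedExp hA).map_one
  have hofQ1 : ofL2 Q 1 = (κ : ℂ) • 1 := by
    apply vec.injective
    rw [vec_ofL2, hQ1, map_smul]
  have hΨ1 : Ψ 1 = ((κ - c / 2 : ℝ) : ℂ) • 1 := by
    rw [hΨQ, LinearMap.sub_apply, LinearMap.smul_apply, hofQ1, hE1]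
    push_cast
    module
  have hΨs : IsSelfAdjoint (toL2 Ψ) := by
    rw [hΨQ, toL2_sub, toL2_ofL2, toL2_smul]
    exact hQs.sub ((hsa _).smul (isSelfAdjoint_fixedExp A))
  have hQcp : IsCompletelyPositive (ofL2 Q) := by
    have : ofL2 Q = Ψ + ((c / 2 : ℝ) : ℂ) • fixedExp A := by rw [hΨQ, sub_add_cancel]
    rw [this]
    exact hΨ.add ((isMarkov_fixedExp hA).completelyPositive.smul (by linarith))
  let B : SuperOp ι := (κ : ℂ) • LinearMap.id - ofL2 Q
  have hB : toL2 B = (2 / δ ^ 2) • (∫ t in (0 : ℝ)..δ, (1 - toL2 (semigroup A t))) +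
      c • ∫ t in s..(s + 1), (1 - toL2 (semigroup A t)) := by
    have h : ∀ a b : ℝ, ∫ t in a..b, ((1 : HS ι →L[ℂ] HS ι) - toL2 (semigroup A t)) =
        (b - a) • 1 - ∫ t in a..b, toL2 (semigroup A t) := by
      intro a b
      rw [intervalIntegral.integral_sub (continuous_const.intervalIntegrable _ _)
        (intervalIntegrable_semigroup A _ _), intervalIntegral.integral_const]
    rw [h, h]
    simp only [B, toL2_sub, toL2_smul, toL2_ofL2, toL2_id, Q, κ, Complex.coe_smul]
    change _ = (2 / δ ^ 2) • ((δ - 0) • (1 : HS ι →L[ℂ] HS ι) - I₁) + c • ((s + 1 - s) • 1 - I₂)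
    module
  refine ⟨B, Ψ, fun t => t * twoBump δ s c t, κ - c / 2, isGenerator_smul_id_sub hQcp hofQ1 ?_,
    ⟨?_, ?_, ?_⟩, ?_, hΨ, hΨ1, hΨs, ?_⟩
  · rwa [toL2_ofL2]
  · intro t ht
    refine mul_nonneg ht.le (add_nonneg (Set.indicator_nonneg (fun _ _ => hδ2) _)
      (Set.indicator_nonneg (fun _ _ => hc) _))
  · have hm : Continuous fun t : ℝ => min 1 t := continuous_const.min continuous_id
    have hi := ((integrable_indicator_Ioc_smul hm 0 δ (2 / δ ^ 2)).add
      (integrable_indicator_Ioc_smul hm s (s + 1) c)).integrableOn (s := Set.Ioi 0)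
    refine hi.congr_fun (fun t ht => ?_) measurableSet_Ioi
    have ht' : t ≠ 0 := ne_of_gt ht
    simp only [twoBump, Pi.add_apply, smul_eq_mul]
    field_simp
  · intro x
    have hcont : Continuous fun t => vec (x - semigroup A t x) := by
      have : (fun t => vec (x - semigroup A t x)) =
          fun t => vec x - toL2 (semigroup A t) (vec x) := by
        ext1 t
        rw [map_sub, toL2_vec]
      rw [this]
      exact continuous_const.sub ((continuous_semigroup A).clm_apply continuous_const)
    have h1 : ∫ t in Set.Ioi (0 : ℝ), (t * twoBump δ s c t / t) • vec (x - semigroup A t x) =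
        ∫ t in Set.Ioi (0 : ℝ), ((Set.Ioc 0 δ).indicator (fun _ => 2 / δ ^ 2) t •
          vec (x - semigroup A t x) +
          (Set.Ioc s (s + 1)).indicator (fun _ => c) t • vec (x - semigroup A t x)) := by
      refine setIntegral_congr_fun measurableSet_Ioi fun t ht => ?_
      have ht' : t ≠ 0 := ne_of_gt ht
      simp only [twoBump]
      rw [← add_smul, mul_div_cancel_left₀ _ ht']
    rw [h1, integral_add (integrable_indicator_Ioc_smul hcont _ _ _).integrableOn
      (integrable_indicator_Ioc_smul hcont _ _ _).integrableOn,
      setIntegral_indicator_Ioc_smul _ le_rfl hδ.le, setIntegral_indicator_Ioc_smul _ hs0 hss,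
      ← toL2_vec, hB, add_apply, smul_apply, smul_apply,
      ContinuousLinearMap.intervalIntegral_apply, ContinuousLinearMap.intervalIntegral_apply]
    · rfl
    · exact (continuous_const.sub (continuous_semigroup A)).intervalIntegrable _ _
    · exact (continuous_const.sub (continuous_semigroup A)).intervalIntegrable _ _
  · rw [toL2_sub, hB, ← sub_sub]
    refine (norm_sub_le _ _).trans (add_le_add hδη ?_)
    rw [norm_smul, Real.norm_of_nonneg hc, mul_comm 2 c]
    refine mul_le_mul_of_nonneg_left ?_ hc
    have h2 : ∀ t ∈ Set.uIoc s (s + 1), ‖(1 : HS ι →L[ℂ] HS ι) - toL2 (semigroup A t)‖ ≤ 2 := by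
      intro t ht
      rw [Set.uIoc_of_le hss] at ht
      have h3 := norm_toL2_semigroup_le hA (hs0.trans ht.1.le)
      have h4 := norm_toL2_semigroup_le hA le_rfl
      rw [semigroup_zero, toL2_id] at h4
      exact (norm_sub_le _ _).trans (by linarith)
    simpa using intervalIntegral.norm_integral_le_of_norm_le_const h2
  · simp only [B, hΨQ]
    push_cast
    module

/-- `B` has the same fixed points as `A`: its Dirichlet form dominates `λ ‖x - E_N(x)‖²`, and
`(I - T_t) x = 0` for `x ∈ N`. -/
theorem fixedPoints_eq_of_decomposition {A B Ψ : SuperOp ι} {F : ℝ → ℝ} {lam κ : ℝ} (hlam : 0 < lam)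
    (hB : IsSubordinated A B F) (hΨ : IsCompletelyPositive Ψ)
    (hΨ1 : Ψ 1 = (κ : ℂ) • 1) (hΨs : IsSelfAdjoint (toL2 Ψ))
    (h : B = (lam : ℂ) • (LinearMap.id - fixedExp A) + ((κ : ℂ) • LinearMap.id - Ψ)) :
    fixedPoints B = fixedPoints A := by
  ext x
  rw [mem_fixedPoints_iff, mem_fixedPoints_iff]
  constructor
  · intro hx
    have h0 : (xᴴ * B x).trace.re = 0 := by rw [hx]; simp
    have h1 := re_trace_conjTranspose_mul_map_le hΨ hΨs hΨ1 x
    have h2 : (xᴴ * (x - fixedExp A x)).trace = ((‖vec (x - fixedExp A x)‖ ^ 2 : ℝ) : ℂ) := by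
      rw [norm_vec_sq_coe, Matrix.conjTranspose_sub, sub_mul, Matrix.trace_sub]
      have : ((fixedExp A x)ᴴ * (x - fixedExp A x)).trace = 0 := by
        rw [(isSelfAdjoint_toL2_iff _).1 (isSelfAdjoint_fixedExp A), map_sub,
          fixedExp_of_mem (fixedExp_mem A x), sub_self, Matrix.mul_zero, Matrix.trace_zero]
      rw [this, sub_zero]
    have h3 : (xᴴ * B x).trace.re = lam * ‖vec (x - fixedExp A x)‖ ^ 2 +
        (κ * ‖vec x‖ ^ 2 - (xᴴ * Ψ x).trace.re) := by
      rw [h]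
      simp only [LinearMap.add_apply, LinearMap.smul_apply, LinearMap.sub_apply, LinearMap.id_apply,
        mul_add, Matrix.mul_smul, mul_sub xᴴ ((κ : ℂ) • x), Matrix.trace_add, Matrix.trace_smul,
        Matrix.trace_sub, h2, smul_eq_mul, Complex.add_re, Complex.sub_re, Complex.re_ofReal_mul,
        Complex.ofReal_re, norm_vec_sq x]
    have h4 : ‖vec (x - fixedExp A x)‖ ^ 2 ≤ 0 := by
      by_contra hn
      have := mul_pos hlam (not_le.1 hn)
      linarith
    have h5 : vec (x - fixedExp A x) = 0 :=
      norm_eq_zero.1 (sq_eq_zero_iff.1 (le_antisymm h4 (sq_nonneg _)))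
    rw [← mem_fixedPoints_iff, sub_eq_zero.1 (vec.map_eq_zero_iff.1 h5)]
    exact fixedExp_mem A x
  · intro hx
    apply vec.injective
    rw [hB.2.2 x]
    simp [semigroup_apply_of_eq_zero hx]

end Construction

/-! ### Approximation and density -/

theorem mainTheorem5 (m : ℕ) :
    (∀ L : SuperOp (Fin m), IsGenerator L →
      (returnTimes L).Nonempty ∧
      ∀ t₀ : ℝ, t₀ = max (Real.exp 1) (returnTime L) →
        ∃ α : ℝ, 0 < α ∧
          (2 * Real.exp 1 * Real.log t₀ * (Real.log t₀ + ‖toL2 L‖ ^ 2))⁻¹ ≤ α ∧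
          α ≤ (2 * Real.log t₀ * (Real.log t₀ + ‖toL2 L‖ ^ 2))⁻¹ ∧
          ∀ ε : ℝ, 0 < ε →
            ∃ (B : SuperOp (Fin m)) (F : ℝ → ℝ),
              IsGenerator B ∧ IsSubordinated L B F ∧ ‖toL2 (L - B)‖ ≤ ε ∧
              GradLE (ε * α) (LinearMap.id - fixedExp L) B) ∧
    (∀ L : SuperOp (Fin m), IsGenerator L → ∀ ε : ℝ, 0 < ε →
      ∃ B : SuperOp (Fin m), IsGenerator B ∧ ‖toL2 (L - B)‖ < ε ∧
        ∃ lam : ℝ, 0 < lam ∧ GammaE lam B ∧ CLSI lam B) := by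
  refine ⟨fun L hL => ⟨returnTimes_nonempty hL, fun t₀ ht₀ => ?_⟩, fun L hL ε hε => ?_⟩
  · have hlog : 1 ≤ Real.log t₀ := by
      rw [Real.le_log_iff_exp_le (ht₀ ▸ lt_max_of_lt_left (Real.exp_pos 1)), ht₀]
      exact le_max_left _ _
    set l := Real.log t₀
    set D := l * (l + ‖toL2 L‖ ^ 2) with hD
    have hD1 : 1 ≤ D := one_le_mul_of_one_le_of_one_le hlog (by linarith [sq_nonneg ‖toL2 L‖])
    have he : 1 ≤ Real.exp 1 := Real.one_le_exp zero_le_one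
    have hlow : 2 * Real.exp 1 * l * (l + ‖toL2 L‖ ^ 2) = 2 * Real.exp 1 * D := by rw [hD]; ring
    have hup : 2 * l * (l + ‖toL2 L‖ ^ 2) = 2 * D := by rw [hD]; ring
    have hpos : 0 < 2 * Real.exp 1 * D := by positivity
    rw [hlow, hup]
    refine ⟨(2 * Real.exp 1 * D)⁻¹, inv_pos.2 hpos, le_rfl, ?_, fun ε hε => ?_⟩
    · apply inv_anti₀ (by linarith)
      nlinarith
    · set α := (2 * Real.exp 1 * D)⁻¹ with hα
      have hα0 : 0 < α := inv_pos.2 hpos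
      -- Since `8 / 3 ≤ e`, the second bump perturbs by at most `3 ε / 4`.
      have hα1 : α ≤ 3 / 16 := by
        rw [hα, inv_le_comm₀ hpos (by norm_num)]
        have := Real.exp_one_gt_d9
        nlinarith
      obtain ⟨s, hs⟩ := returnTimes_nonempty hL
      obtain ⟨B, Ψ, F, κ, hB, hBF, hLB, hΨ, hΨ1, hΨs, hdec⟩ := exists_subordinated_generator hL hs
        (c := 2 * (ε * α)) (η := ε / 4) (by positivity) (by positivity)
      refine ⟨B, F, hB, hBF, hLB.trans ?_, gradLE_of_completelyPositive hΨ hΨ1 ?_⟩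
      · nlinarith
      · rw [mul_div_cancel_left₀ _ two_ne_zero] at hdec
        exact hdec
  · obtain ⟨s, hs⟩ := returnTimes_nonempty hL
    obtain ⟨B, Ψ, F, κ, hB, hBF, hLB, hΨ, hΨ1, hΨs, hdec⟩ := exists_subordinated_generator hL hs
      (c := ε / 8) (η := ε / 4) (by positivity) (by positivity)
    have hE : fixedExp B = fixedExp L :=
      fixedExp_congr (fixedPoints_eq_of_decomposition (by positivity) hBF hΨ hΨ1 hΨs hdec)
    rw [← hE] at hdec
    exact ⟨B, hB, by linarith, ε / 8 / 2, by positivity,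
      gradLE_of_completelyPositive hΨ hΨ1 hdec,
      clsi_of_decomposition (by positivity) hB hΨ hΨ1 hΨs hdec⟩
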